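/- Let $n\ge 1$, $p>0$, and let $f$ be a log-concave (not necessarily symmetric) probability density on $\mathbb{R}^n$, i.e. $f:\mathbb{R}^n\to[0,\infty)$ is measurable, $\int f=1$ and $f(\lambda x+(1-\lambda)y)\ge f(x)^{\lambda}f(y)^{1-\lambda}$ for all $x,y\in\mathbb{R}^n$, $\lambda\in[0,1]$. For $\rho:S^{n-1}\to[0,\infty]$, the set with radial function $\rho$ is $\{rv: v\in S^{n-1},\ 0\le r<\infty,\ r\le\rho(v)\}$. For $q\neq 0$, a nonnegative function $g$ on $\mathbb{R}^n$ and a set $K\subseteq\mathbb{R}^n$, let $C_q(g)$, $R_q(g)$, $B_q(g)$, $I(g)$, $I(K)$ be the sets with radial functions (at $v\in S^{n-1}$) $$\rho_{C_q(g)}(v)=\Big(\int_{\mathbb{R}^n}\Big(\int_{x+v^\perp}g(y)\,dy\Big)^{q}g(x)\,dx\Big)^{1/q},\qquad \rho_{R_q(g)}(v)=\Big(\int_{\mathbb{R}^n}g(x)\int_0^\infty r^{q-1}g(x+rv)\,dr\,dx\Big)^{1/q},$$ $$\rho_{B_q(g)}(v)=\Big(\int_0^\infty r^{q-1}g(rv)\,dr\Big)^{1/q},\qquad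 \rho_{I(g)}(v)=\int_{v^\perp}g(x)\,dx,\qquad \rho_{I(K)}(v)=|K\cap v^\perp|,$$ where $v^\perp$ is the hyperplane through the origin perpendicular to $v$ and $|\cdot|$ and the integrals over $v^\perp$ and its translates refer to $(n-1)$-dimensional Lebesgue measure (the unit point mass if $n=1$). Put $$\hat f(x)=\int_{\mathbb{R}^n}f(y)f(x+y)\,dy .$$ Then the integral defining $\hat f(x)$ converges for every $x$, and $\hat f$ is a symmetric (that is, even) log-concave probability density. The sets $C_1(f)$ and $R_p(f)$ are symmetric convex bodies (compact convex sets with nonempty interior that are symmetric about the origin). Furthermore $$C_1(f)=I(\hat f),\qquad R_p(f)=B_p(\hat f),$$ and, if $n\ge 2$, also $$C_1(f)=(n-1)\,I(R_{n-1}(f)).$$ -/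

import Mathlib

open MeasureTheory
open scoped ENNReal NNReal Pointwise

noncomputable section

/-- Euclidean space of dimension `n`. -/
abbrev E (n : ℕ) : Type := EuclideanSpace ℝ (Fin n)

/-- `f` is a probability density with respect to Lebesgue measure. -/
structure IsProbabilityDensity {n : ℕ} (f : E n → ℝ) : Prop where
  measurable : Measurable f
  nonneg : ∀ x, 0 ≤ f x
  integrable : Integrable f volume
  integral_eq_one : ∫ x, f x = 1

/-- Log-concavity of a nonnegative function. -/
def IsLogConcave {n : ℕ} (f : E n → ℝ) : Prop :=
  ∀ x y : E n, ∀ a b : ℝ, 0 ≤ a → 0 ≤ b → a + b = 1 →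
    f x ^ a * f y ^ b ≤ f (a • x + b • y)

/-- Convex, compact, with nonempty interior, and symmetric about the origin. -/
structure IsSymmetricConvexBody {n : ℕ} (K : Set (E n)) : Prop where
  convex : Convex ℝ K
  isCompact : IsCompact K
  interior_nonempty : (interior K).Nonempty
  neg_mem : ∀ x ∈ K, -x ∈ K

/-- The set with radial function `ρ`: on the ray in the unit direction `v` it consists of the points
`r v` with `0 ≤ r ≤ ρ v`. Only the values of `ρ` on the unit sphere matter. -/
def bodyOfRadial {n : ℕ} (ρ : E n → ℝ≥0∞) : Set (E n) :=
  {x | ∃ v : E n, ‖v‖ = 1 ∧ ∃ r : ℝ≥0, (r : ℝ≥0∞) ≤ ρ v ∧ x = (r : ℝ) • v}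

/-- The hyperplane through the origin perpendicular to `v`; it is integrated over with its
own `(n - 1)`-dimensional Lebesgue measure. -/
abbrev perp {n : ℕ} (v : E n) : Submodule ℝ (E n) := (Submodule.span ℝ {v})ᗮ

/-- The `p`-th cross-section body `C_p(f)`, for `p ≠ 0`:
`ρ(v) = (∫ (∫_{x + v^⊥} f(y) dy)^p f(x) dx)^{1/p}`. -/
def crossSectionBody {n : ℕ} (p : ℝ) (f : E n → ℝ) : Set (E n) :=
  bodyOfRadial fun v =>
    (∫⁻ x : E n, (∫⁻ z : perp v, ENNReal.ofReal (f (x + z))) ^ p * ENNReal.ofReal (f x)) ^ (1 / p)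

/-- The intersection body `I(f)` of a density: `ρ(v) = ∫_{v^⊥} f`. -/
def intersectionBodyOfDensity {n : ℕ} (f : E n → ℝ) : Set (E n) :=
  bodyOfRadial fun v => ∫⁻ z : perp v, ENNReal.ofReal (f z)

/-- The intersection body `I(K)` of a set: `ρ(v) = |K ∩ v^⊥|`, the `(n - 1)`-dimensional volume. -/
def intersectionBody {n : ℕ} (K : Set (E n)) : Set (E n) :=
  bodyOfRadial fun v => volume {z : perp v | (z : E n) ∈ K}

/-- The `p`-th radial mean body `R_p(f)`:
`ρ(v) = (∫ f(x) ∫_0^∞ r^{p-1} f(x + r v) dr dx)^{1/p}`. -/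
def radialMeanBody {n : ℕ} (p : ℝ) (f : E n → ℝ) : Set (E n) :=
  bodyOfRadial fun v =>
    (∫⁻ x : E n, ENNReal.ofReal (f x) *
      ∫⁻ r in Set.Ioi (0 : ℝ), ENNReal.ofReal (r ^ (p - 1) * f (x + r • v))) ^ (1 / p)

/-- Ball's `p`-th mean body `B_p(f)`: `ρ(v) = (∫_0^∞ r^{p-1} f(r v) dr)^{1/p}`. -/
def ballBody {n : ℕ} (p : ℝ) (f : E n → ℝ) : Set (E n) :=
  bodyOfRadial fun v =>
    (∫⁻ r in Set.Ioi (0 : ℝ), ENNReal.ofReal (r ^ (p - 1) * f (r • v))) ^ (1 / p)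

/-- The autocorrelation `x ↦ ∫ f(y) f(x + y) dy`. -/
def autocorrelation {n : ℕ} (f : E n → ℝ) (x : E n) : ℝ :=
  ∫ y : E n, f y * f (x + y)

end

/-! ### The Prékopa–Leindler inequality: the line, products, Euclidean space. -/

section PrekopaLeindler

open Filter Topology

/-! The autocorrelation `g` of `f` carries everything. Tonelli gives `∫ f(x) ∫_{v^⊥} f(x + z) dz dx
= ∫_{v^⊥} g`, and likewise along rays, so `C_1(f) = I(g)` and `R_p(f) = B_p(g)` at once. The
function `(x, y) ↦ f(y) f(x + y)` is log-concave, hence so is its marginal `g`, by Prékopa–Leindler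
(`prekopaLeindler_euclideanSpace`); evenness is a translation. It remains to treat an even
log-concave density `g`.

Convexity of `B_p(g)` is Ball's theorem. Its core is a three-function inequality on the half-line
(`IsRadialProfile.one_le_lintegral`), proved by transporting the uniform measure on `(0, 1)` to two
radial measures and taking the weighted harmonic mean of the two maps.

Convexity of `I(g)` is Busemann's theorem. For independent `x`, `y`, integrating `g` over the
orthogonal complement of their plane leaves an even log-concave function there. Hyperplane integrals
of `g` become line integrals of it, that is, radial moments with `p = 1` in the direction turned by
a right angle; Ball's inequality applies again (`convex_intersectionBodyOfDensity`).

Since `g` is bounded below near `0` and decays exponentially, the radial functions lie between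
positive constants; with convexity this yields convex bodies. Finally, polar coordinates in `v^⊥`
give `∫_{v^⊥} g = (n - 1) |B_{n-1}(g) ∩ v^⊥|` (`hyperplaneIntegral_eq_volume`). -/

/-- The translates `min L + K` and `max K + L` both lie in `K + L` and share at most the point `max
K + min L`. -/
theorem volume_add_le_of_isCompact {K L : Set ℝ} (hK : IsCompact K) (hL : IsCompact L)
    (hK0 : K.Nonempty) (hL0 : L.Nonempty) : volume K + volume L ≤ volume (K + L) := by
  obtain ⟨m, hm, hmL⟩ := hL.exists_isLeast hL0
  obtain ⟨M, hM, hMK⟩ := hK.exists_isGreatest hK0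
  have h1 : volume ((m +ᵥ K) ∪ (M +ᵥ L)) = volume K + volume L := by
    rw [measure_union₀' (hK.measurableSet.const_vadd m).nullMeasurableSet, measure_vadd,
      measure_vadd]
    refine measure_mono_null (t := {m + M}) ?_ (measure_singleton _)
    rintro x ⟨⟨k, hk, rfl⟩, ⟨l, hl, h⟩⟩
    have := hmL hl
    have := hMK hk
    simp only [vadd_eq_add, Set.mem_singleton_iff] at h ⊢
    linarith
  rw [← h1]
  apply measure_mono
  rintro x (⟨k, hk, rfl⟩ | ⟨l, hl, rfl⟩)
  · exact ⟨k, hk, m, hm, add_comm _ _⟩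
  · exact ⟨M, hM, l, hl, rfl⟩

/-- Inner regularity, applied to one set at a time. Only monotonicity of the measure is used on `A +
B`, so its measurability plays no role. -/
theorem volume_add_volume_le {A B : Set ℝ} (hA : MeasurableSet A) (hB : MeasurableSet B)
    (hA0 : A.Nonempty) (hB0 : B.Nonempty) : volume A + volume B ≤ volume (A + B) := by
  have step : ∀ L : Set ℝ, IsCompact L → L ⊆ B → L.Nonempty →
      volume A + volume L ≤ volume (A + B) := by
    intro L hL hLB hL0
    by_cases hle : volume L ≤ volume (A + B)
    · rw [← ENNReal.le_sub_iff_add_le_right hL.measure_ne_top hle]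
      refine le_of_forall_lt_imp_le_of_dense fun r hr => ?_
      obtain ⟨K, hKA, hK, hrK⟩ := hA.exists_lt_isCompact hr
      have hK0 : K.Nonempty := by
        rw [Set.nonempty_iff_ne_empty]
        rintro rfl
        simp at hrK
      rw [ENNReal.le_sub_iff_add_le_right hL.measure_ne_top hle]
      calc r + volume L ≤ volume K + volume L := by gcongr
        _ ≤ volume (K + L) := volume_add_le_of_isCompact hK hL hK0 hL0
        _ ≤ _ := measure_mono (Set.add_subset_add hKA hLB)
    · exfalso
      obtain ⟨x, hx⟩ := hA0
      apply hle
      rw [← measure_vadd volume x L]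
      apply measure_mono
      rintro _ ⟨l, hl, rfl⟩
      exact ⟨x, hx, l, hLB hl, rfl⟩
  by_cases hT : volume (A + B) = ⊤
  · simp [hT]
  have hAle : volume A ≤ volume (A + B) := by
    obtain ⟨y, hy⟩ := hB0
    simpa using step {y} isCompact_singleton (by simpa using hy) (by simp)
  have hAT : volume A ≠ ⊤ := ne_top_of_le_ne_top hT hAle
  rw [← ENNReal.le_sub_iff_add_le_left hAT hAle]
  refine le_of_forall_lt_imp_le_of_dense fun r hr => ?_
  obtain ⟨L, hLB, hL, hrL⟩ := hB.exists_lt_isCompact hr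
  have hL0 : L.Nonempty := by
    rw [Set.nonempty_iff_ne_empty]
    rintro rfl
    simp at hrL
  rw [ENNReal.le_sub_iff_add_le_left hAT hAle]
  calc volume A + r ≤ volume A + volume L := by gcongr
    _ ≤ _ := step L hL hLB hL0

theorem lintegral_eq_lintegral_volume_lt {u : ℝ → ℝ≥0∞} (hu : Measurable u) :
    ∫⁻ x, u x = ∫⁻ c in Set.Ioi (0 : ℝ), volume {x | ENNReal.ofReal c < u x} := by
  have hset : MeasurableSet {q : ℝ × ℝ | ENNReal.ofReal q.2 < u q.1} :=
    measurableSet_lt (ENNReal.measurable_ofReal.comp measurable_snd) (hu.comp measurable_fst)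
  have h1 : ∀ x, u x = ∫⁻ c in Set.Ioi (0 : ℝ),
      Set.indicator {q : ℝ × ℝ | ENNReal.ofReal q.2 < u q.1} (fun _ => 1) (x, c) := by
    intro x
    have : (fun c : ℝ => Set.indicator {q : ℝ × ℝ | ENNReal.ofReal q.2 < u q.1}
        (fun _ => (1 : ℝ≥0∞)) (x, c)) = Set.indicator {c | ENNReal.ofReal c < u x} 1 := by
      ext c; simp [Set.indicator]
    have hm : MeasurableSet {c : ℝ | ENNReal.ofReal c < u x} :=
      measurableSet_lt ENNReal.measurable_ofReal measurable_const
    rw [this, lintegral_indicator_one hm, Measure.restrict_apply hm]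
    by_cases hx : u x = ⊤
    · have : {c : ℝ | ENNReal.ofReal c < u x} ∩ Set.Ioi 0 = Set.Ioi 0 := by
        ext c; simp [hx]
      rw [this, hx, Real.volume_Ioi]
    · have : {c : ℝ | ENNReal.ofReal c < u x} ∩ Set.Ioi 0 = Set.Ioo 0 (u x).toReal := by
        ext c
        simp only [Set.mem_inter_iff, Set.mem_ofPred_eq, Set.mem_Ioi, Set.mem_Ioo]
        constructor
        · rintro ⟨h, h0⟩
          exact ⟨h0, by rwa [ENNReal.ofReal_lt_iff_lt_toReal h0.le hx] at h⟩
        · rintro ⟨h0, h⟩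
          exact ⟨by rwa [ENNReal.ofReal_lt_iff_lt_toReal h0.le hx], h0⟩
      rw [this, Real.volume_Ioo, sub_zero, ENNReal.ofReal_toReal hx]
  rw [lintegral_congr h1, lintegral_lintegral_swap]
  · refine lintegral_congr fun c => ?_
    have : (fun x : ℝ => Set.indicator {q : ℝ × ℝ | ENNReal.ofReal q.2 < u q.1}
        (fun _ => (1 : ℝ≥0∞)) (x, c)) = Set.indicator {x | ENNReal.ofReal c < u x} 1 := by
      ext x; simp [Set.indicator]
    rw [this, lintegral_indicator_one (measurableSet_lt measurable_const hu)]
  · exact (measurable_const.indicator hset).aemeasurable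

theorem ENNReal.geom_mean_le_arith_mean_of_add_eq_one {a b : ℝ} (ha : 0 < a) (hb : 0 < b)
    (hab : a + b = 1) (X Y : ℝ≥0∞) :
    X ^ a * Y ^ b ≤ ENNReal.ofReal a * X + ENNReal.ofReal b * Y := by
  have hpq : (a⁻¹).HolderConjugate b⁻¹ := by
    rw [Real.holderConjugate_iff]
    refine ⟨(one_lt_inv₀ ha).2 (by linarith), by simpa⟩
  refine (ENNReal.young_inequality (X ^ a) (Y ^ b) hpq).trans (le_of_eq ?_)
  rw [← ENNReal.rpow_mul, ← ENNReal.rpow_mul, mul_inv_cancel₀ ha.ne', mul_inv_cancel₀ hb.ne',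
    ENNReal.rpow_one, ENNReal.rpow_one, ENNReal.ofReal_inv_of_pos ha, ENNReal.ofReal_inv_of_pos hb,
    div_eq_mul_inv, div_eq_mul_inv, inv_inv, inv_inv, mul_comm, mul_comm Y]

/-- The hypothesis gives `a {u > c} + b {v > c} ⊆ {w > c}`. With both suprema equal to `1`, the two
sets are nonempty for the same levels `c < 1`, so one-dimensional Brunn–Minkowski can be integrated
over `c ∈ (0, 1)`. -/
theorem add_lintegral_le_of_iSup_eq_one {a b : ℝ} (ha : 0 < a) (hb : 0 < b) (hab : a + b = 1)
    {u v w : ℝ → ℝ≥0∞} (hu : Measurable u) (hv : Measurable v) (hw : Measurable w)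
    (hsu : ⨆ x, u x = 1) (hsv : ⨆ x, v x = 1)
    (h : ∀ x y, u x ^ a * v y ^ b ≤ w (a • x + b • y)) :
    ENNReal.ofReal a * (∫⁻ x, u x) + ENNReal.ofReal b * (∫⁻ x, v x) ≤ ∫⁻ x, w x := by
  have key : ∀ {u : ℝ → ℝ≥0∞}, Measurable u → ⨆ x, u x = 1 →
      ∫⁻ x, u x = ∫⁻ c in Set.Ioo (0 : ℝ) 1, volume {x | ENNReal.ofReal c < u x} := by
    intro u hu hs
    rw [lintegral_eq_lintegral_volume_lt hu, ← Set.Ioo_union_Ici_eq_Ioi (zero_lt_one' ℝ),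
      lintegral_union measurableSet_Ici]
    · convert add_zero _
      rw [setLIntegral_eq_zero_iff' measurableSet_Ici]
      · refine ae_of_all _ fun c hc => ?_
        have : {x | ENNReal.ofReal c < u x} = ∅ := by
          ext x
          simp only [Set.mem_ofPred_eq, Set.mem_empty_iff_false, iff_false, not_lt]
          calc u x ≤ ⨆ x, u x := le_iSup u x
            _ = 1 := hs
            _ ≤ _ := by simpa using hc
        rw [this, measure_empty]
      · apply Measurable.aemeasurable
        refine Antitone.measurable fun c d hcd => measure_mono fun x hx => ?_
        exact lt_of_le_of_lt (ENNReal.ofReal_le_ofReal hcd) hx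
    · rw [Set.disjoint_left]
      rintro x hx hx'
      exact absurd hx.2 (not_lt.2 hx')
  have mono : ∀ u : ℝ → ℝ≥0∞, Measurable fun c : ℝ => volume {x | ENNReal.ofReal c < u x} :=
    fun u => Antitone.measurable fun c d hcd => measure_mono fun x hx =>
      lt_of_le_of_lt (ENNReal.ofReal_le_ofReal hcd) hx
  rw [key hu hsu, key hv hsv, lintegral_eq_lintegral_volume_lt hw,
    ← lintegral_const_mul _ (mono u), ← lintegral_const_mul _ (mono v),
    ← lintegral_add_left ((mono u).const_mul _)]
  refine le_trans ?_ (lintegral_mono_set (Set.Ioo_subset_Ioi_self : Set.Ioo (0 : ℝ) 1 ⊆ Set.Ioi 0))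
  refine setLIntegral_mono' measurableSet_Ioo fun c hc => ?_
  have hc1 : ENNReal.ofReal c < 1 := by
    rw [← ENNReal.ofReal_one]; exact (ENNReal.ofReal_lt_ofReal_iff one_pos).2 hc.2
  have nonem : ∀ {u : ℝ → ℝ≥0∞}, ⨆ x, u x = 1 → {x | ENNReal.ofReal c < u x}.Nonempty := by
    intro u hs
    rw [← hs] at hc1
    exact lt_iSup_iff.1 hc1
  have hsm : ∀ (a : ℝ), 0 < a → ∀ s : Set ℝ, ENNReal.ofReal a * volume s = volume (a • s) := by
    intro a ha s
    rw [Measure.addHaar_smul]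
    simp [abs_of_pos ha]
  rw [hsm a ha, hsm b hb]
  refine (volume_add_volume_le ?_ ?_ ((nonem hsu).smul_set) ((nonem hsv).smul_set)).trans
    (measure_mono ?_)
  · exact (measurableSet_lt measurable_const hu).const_smul₀ a
  · exact (measurableSet_lt measurable_const hv).const_smul₀ b
  · rintro _ ⟨_, ⟨x, hx, rfl⟩, _, ⟨y, hy, rfl⟩, rfl⟩
    refine lt_of_lt_of_le ?_ (h x y)
    have hc0 : ENNReal.ofReal c ≠ 0 := by simpa using hc.1
    calc ENNReal.ofReal c = ENNReal.ofReal c ^ a * ENNReal.ofReal c ^ b := by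
          rw [← ENNReal.rpow_add _ _ hc0 ENNReal.ofReal_ne_top, hab, ENNReal.rpow_one]
      _ < u x ^ a * v y ^ b := ENNReal.mul_lt_mul (ENNReal.rpow_lt_rpow hx ha)
          (ENNReal.rpow_lt_rpow hy hb)

/-- The Prékopa–Leindler inequality holds on `α`. -/
def PrekopaLeindler (α : Type*) [MeasureSpace α] [AddCommGroup α] [Module ℝ α] : Prop :=
  ∀ a b : ℝ, 0 < a → 0 < b → a + b = 1 → ∀ u v w : α → ℝ≥0∞, Measurable u → Measurable v →
    Measurable w → (∀ x y, u x ^ a * v y ^ b ≤ w (a • x + b • y)) →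
    (∫⁻ x, u x) ^ a * (∫⁻ x, v x) ^ b ≤ ∫⁻ x, w x

/-- Dividing by the suprema reduces to the normalised case, whose arithmetic mean dominates the
geometric one; the latter is homogeneous, so the scaling cancels. -/
theorem lintegral_rpow_mul_le_of_iSup_ne_top {a b : ℝ} (ha : 0 < a) (hb : 0 < b) (hab : a + b = 1)
    {u v w : ℝ → ℝ≥0∞} (hu : Measurable u) (hv : Measurable v) (hw : Measurable w)
    (hsu : ⨆ x, u x ≠ ⊤) (hsv : ⨆ x, v x ≠ ⊤)
    (h : ∀ x y, u x ^ a * v y ^ b ≤ w (a • x + b • y)) :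
    (∫⁻ x, u x) ^ a * (∫⁻ x, v x) ^ b ≤ ∫⁻ x, w x := by
  by_cases hM0 : ⨆ x, u x = 0
  · have : ∀ x, u x = 0 := by simpa using hM0
    simp [this, ha]
  by_cases hN0 : ⨆ x, v x = 0
  · have : ∀ x, v x = 0 := by simpa using hN0
    simp [this, hb]
  set M := ⨆ x, u x with hM
  set N := ⨆ x, v x with hN
  have hMa0 : M ^ a ≠ 0 := by simp [hM0, hsu]
  have hMat : M ^ a ≠ ⊤ := by simp [hM0, hsu]
  have hNb0 : N ^ b ≠ 0 := by simp [hN0, hsv]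
  have hNbt : N ^ b ≠ ⊤ := by simp [hN0, hsv]
  have h1 := add_lintegral_le_of_iSup_eq_one ha hb hab (u := fun x => M⁻¹ * u x)
    (v := fun x => N⁻¹ * v x) (w := fun x => (M ^ a)⁻¹ * (N ^ b)⁻¹ * w x)
    (hu.const_mul _) (hv.const_mul _) (hw.const_mul _)
    (by rw [← ENNReal.mul_iSup, ← hM, ENNReal.inv_mul_cancel hM0 hsu])
    (by rw [← ENNReal.mul_iSup, ← hN, ENNReal.inv_mul_cancel hN0 hsv]) (by
      intro x y
      rw [ENNReal.mul_rpow_of_nonneg _ _ ha.le, ENNReal.mul_rpow_of_nonneg _ _ hb.le,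
        ENNReal.inv_rpow, ENNReal.inv_rpow, mul_mul_mul_comm]
      gcongr
      exact h x y)
  have h2 := (ENNReal.geom_mean_le_arith_mean_of_add_eq_one ha hb hab _ _).trans h1
  rw [lintegral_const_mul _ hu, lintegral_const_mul _ hv, lintegral_const_mul _ hw,
    ENNReal.mul_rpow_of_nonneg _ _ ha.le, ENNReal.mul_rpow_of_nonneg _ _ hb.le,
    ENNReal.inv_rpow, ENNReal.inv_rpow, mul_mul_mul_comm] at h2
  rwa [ENNReal.mul_le_mul_iff_right] at h2
  · exact mul_ne_zero (ENNReal.inv_ne_zero.2 hMat) (ENNReal.inv_ne_zero.2 hNbt)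
  · exact ENNReal.mul_ne_top (ENNReal.inv_ne_top.2 hMa0) (ENNReal.inv_ne_top.2 hNb0)

theorem tendsto_lintegral_min_natCast {α : Type*} [MeasureSpace α] {u : α → ℝ≥0∞}
    (hu : Measurable u) :
    Tendsto (fun k : ℕ => ∫⁻ x, min (u x) k) atTop (𝓝 (∫⁻ x, u x)) := by
  refine lintegral_tendsto_of_tendsto_of_monotone
    (fun k => (hu.min measurable_const).aemeasurable)
    (ae_of_all _ fun x k l hkl => min_le_min le_rfl (by exact_mod_cast hkl))
    (ae_of_all _ fun x => ?_)
  simpa using (tendsto_const_nhds (x := u x)).min ENNReal.tendsto_nat_nhds_top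

theorem prekopaLeindler_real : PrekopaLeindler ℝ := by
  intro a b ha hb hab u v w hu hv hw h
  -- Both integrals must be nonzero for the product to be continuous at the limit, where `0 * ⊤`
  -- could otherwise occur.
  by_cases hu0 : ∫⁻ x, u x = 0
  · simp [hu0, ha]
  by_cases hv0 : ∫⁻ x, v x = 0
  · simp [hv0, hb]
  have h1 : ∀ k : ℕ, (∫⁻ x, min (u x) k) ^ a * (∫⁻ x, min (v x) k) ^ b ≤ ∫⁻ x, w x := by
    intro k
    refine lintegral_rpow_mul_le_of_iSup_ne_top ha hb hab (hu.min measurable_const)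
      (hv.min measurable_const) hw ?_ ?_ ?_
    · exact ne_top_of_le_ne_top (ENNReal.natCast_ne_top k) (iSup_le fun x => min_le_right _ _)
    · exact ne_top_of_le_ne_top (ENNReal.natCast_ne_top k) (iSup_le fun x => min_le_right _ _)
    · intro x y
      refine le_trans ?_ (h x y)
      gcongr <;> exact min_le_left _ _
  refine le_of_tendsto' (ENNReal.Tendsto.mul
    (((ENNReal.continuous_rpow_const (y := a)).tendsto _).comp (tendsto_lintegral_min_natCast hu)) (Or.inl ?_)
    (((ENNReal.continuous_rpow_const (y := b)).tendsto _).comp (tendsto_lintegral_min_natCast hv)) (Or.inl ?_)) h1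
  · simp [hu0, ha.le, ha]
  · simp [hv0, hb.le, hb]

/-- The inequality on the fibres `β` is precisely the hypothesis on `α` for the partial integrals.
-/
theorem PrekopaLeindler.prod {α β : Type*} [MeasureSpace α] [AddCommGroup α] [Module ℝ α]
    [MeasureSpace β] [AddCommGroup β] [Module ℝ β] [SFinite (volume : Measure β)]
    (hα : PrekopaLeindler α) (hβ : PrekopaLeindler β) : PrekopaLeindler (α × β) := by
  intro a b ha hb hab u v w hu hv hw h
  rw [Measure.volume_eq_prod, lintegral_prod _ hu.aemeasurable, lintegral_prod _ hv.aemeasurable,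
    lintegral_prod _ hw.aemeasurable]
  refine hα a b ha hb hab _ _ _ hu.lintegral_prod_right' hv.lintegral_prod_right'
    hw.lintegral_prod_right' fun x y => ?_
  exact hβ a b ha hb hab _ _ _ (hu.comp measurable_prodMk_left) (hv.comp measurable_prodMk_left)
    (hw.comp measurable_prodMk_left) fun x' y' => h (x, x') (y, y')

theorem PrekopaLeindler.of_measurableEquiv {α β : Type*} [MeasureSpace α] [AddCommGroup α]
    [Module ℝ α] [MeasureSpace β] [AddCommGroup β] [Module ℝ β] (hα : PrekopaLeindler α)
    (e : α ≃ᵐ β) (he : MeasurePreserving e)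
    (hlin : ∀ (a b : ℝ) (x y : α), e (a • x + b • y) = a • e x + b • e y) :
    PrekopaLeindler β := by
  intro a b ha hb hab u v w hu hv hw h
  rw [he.lintegral_map_equiv, he.lintegral_map_equiv, he.lintegral_map_equiv]
  refine hα a b ha hb hab _ _ _ (hu.comp e.measurable) (hv.comp e.measurable)
    (hw.comp e.measurable) fun x y => ?_
  simpa [hlin] using h (e x) (e y)

theorem prekopaLeindler_pi (n : ℕ) : PrekopaLeindler (Fin n → ℝ) := by
  induction n with
  | zero =>
    intro a b ha hb hab u v w hu hv hw h
    rw [volume_pi, Measure.pi_of_empty, lintegral_dirac, lintegral_dirac, lintegral_dirac]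
    convert h _ _
  | succ n ih =>
    refine (prekopaLeindler_real.prod ih).of_measurableEquiv
      (MeasurableEquiv.piFinSuccAbove (fun _ => ℝ) 0).symm
      (volume_preserving_piFinSuccAbove (fun _ => ℝ) 0).symm ?_
    intro a b x y
    ext i
    refine Fin.cases ?_ (fun j => ?_) i <;> simp [MeasurableEquiv.piFinSuccAbove, Fin.insertNthEquiv]

theorem prekopaLeindler_euclideanSpace (n : ℕ) : PrekopaLeindler (E n) :=
  (prekopaLeindler_pi n).of_measurableEquiv (MeasurableEquiv.toLp 2 (Fin n → ℝ))
    (PiLp.volume_preserving_toLp (Fin n)) fun a b x y => by ext i; simp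

end PrekopaLeindler

/-! ### Log-concave densities: boundedness, exponential decay, autocorrelation. -/

section LogConcave

variable {n : ℕ}

theorem IsLogConcave.convex_superlevel {f : E n → ℝ} (hlc : IsLogConcave f) {c : ℝ} (hc : 0 < c) :
    Convex ℝ {x | c ≤ f x} := by
  intro x hx y hy a b ha hb hab
  calc c = c ^ a * c ^ b := by rw [← Real.rpow_add hc, hab, Real.rpow_one]
    _ ≤ f x ^ a * f y ^ b := by
      gcongr
      · exact Real.rpow_nonneg (hc.le.trans hx) _
      · exact hx
      · exact hy
    _ ≤ _ := hlc x y a b ha hb hab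

theorem IsLogConcave.comp_line {f : E n → ℝ} (hlc : IsLogConcave f) (hf : ∀ x, 0 ≤ f x)
    {a b u v : ℝ} {x y : E n} (ha : 0 ≤ a) (hb : 0 ≤ b) (hab : a + b = 1)
    (hu : 0 ≤ u) (hux : u ≤ f x) (hv : 0 ≤ v) (hvy : v ≤ f y) :
    u ^ a * v ^ b ≤ f (a • x + b • y) := by
  refine le_trans ?_ (hlc x y a b ha hb hab)
  gcongr
  exact Real.rpow_nonneg (hf x) _

theorem IsProbabilityDensity.measureReal_superlevel_le {f : E n → ℝ} (hf : IsProbabilityDensity f)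
    (c : ℝ) : c * volume.real {x | c ≤ f x} ≤ 1 := by
  rw [← hf.integral_eq_one]
  exact mul_meas_ge_le_integral_of_nonneg (ae_of_all _ hf.nonneg) hf.integrable c

theorem IsProbabilityDensity.measure_superlevel_ne_top {f : E n → ℝ} (hf : IsProbabilityDensity f)
    {c : ℝ} (hc : 0 < c) : volume {x | c ≤ f x} ≠ ⊤ :=
  (hf.integrable.measure_ge_lt_top hc).ne

/-- Some superlevel set has positive measure. It is convex, and a convex set without interior is
contained in its frontier, which is null. -/
theorem IsProbabilityDensity.exists_ball_le {f : E n → ℝ} (hf : IsProbabilityDensity f)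
    (hlc : IsLogConcave f) :
    ∃ x₀, ∃ ε > 0, ∃ c > 0, ∀ y ∈ Metric.ball x₀ ε, c ≤ f y := by
  have h1 : ∃ k : ℕ, volume {x | 1 / ((k : ℝ) + 1) ≤ f x} ≠ 0 := by
    by_contra! h
    have h0 : f =ᵐ[volume] 0 := by
      rw [Filter.EventuallyEq, ae_iff]
      refine measure_mono_null ?_ (measure_iUnion_null h)
      intro x hx
      have hpos : 0 < f x := lt_of_le_of_ne (hf.nonneg x) (Ne.symm hx)
      obtain ⟨k, hk⟩ := exists_nat_one_div_lt hpos
      exact Set.mem_iUnion.2 ⟨k, hk.le⟩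
    have := hf.integral_eq_one
    rw [integral_congr_ae h0] at this
    simp at this
  obtain ⟨k, hk⟩ := h1
  have hc : 0 < 1 / ((k : ℝ) + 1) := by positivity
  have hint : (interior {x | 1 / ((k : ℝ) + 1) ≤ f x}).Nonempty := by
    by_contra h
    rw [Set.not_nonempty_iff_eq_empty] at h
    apply hk
    refine measure_mono_null ?_ ((hlc.convex_superlevel hc).addHaar_frontier volume)
    rw [frontier, h, Set.sdiff_empty]
    exact subset_closure
  obtain ⟨x₀, hx₀⟩ := hint
  obtain ⟨ε, hε, hball⟩ := Metric.isOpen_iff.1 isOpen_interior x₀ hx₀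
  refine ⟨x₀, ε, hε, _, hc, fun y hy => ?_⟩
  have : y ∈ {x | 1 / ((k : ℝ) + 1) ≤ f x} := interior_subset (hball hy)
  exact this

theorem measureReal_ball_pos (x : E n) {ε : ℝ} (hε : 0 < ε) :
    0 < volume.real (Metric.ball x ε) :=
  ENNReal.toReal_pos (Metric.measure_ball_pos _ _ hε).ne' measure_ball_lt_top.ne

/-- If `f ≥ c` on a ball of radius `ε` about `x₀`, then `f ≥ √(f x * c)` on the ball of radius `ε /
2` about the midpoint of `x` and `x₀`. Markov's inequality bounds this value independently of `x`.
-/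
theorem IsProbabilityDensity.exists_le {f : E n → ℝ} (hf : IsProbabilityDensity f)
    (hlc : IsLogConcave f) : ∃ M, ∀ x, f x ≤ M := by
  obtain ⟨x₀, ε, hε, c, hc, hball⟩ := hf.exists_ball_le hlc
  have hV := measureReal_ball_pos (0 : E n) (half_pos hε)
  set V := volume.real (Metric.ball (0 : E n) (ε / 2)) with hVdef
  refine ⟨1 / (V ^ 2 * c), fun x => ?_⟩
  set s := f x ^ (1 / 2 : ℝ) * c ^ (1 / 2 : ℝ) with hs
  have hs0 : 0 ≤ s := mul_nonneg (Real.rpow_nonneg (hf.nonneg x) _) (Real.rpow_nonneg hc.le _)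
  have hss : s ^ 2 = f x * c := by
    rw [hs, mul_pow, ← Real.rpow_natCast, ← Real.rpow_natCast, ← Real.rpow_mul (hf.nonneg x),
      ← Real.rpow_mul hc.le]
    norm_num
  have hsub : Metric.ball ((1 / 2 : ℝ) • (x + x₀)) (ε / 2) ⊆ {y | s ≤ f y} := by
    intro y hy
    have hz : (2 : ℝ) • y - x ∈ Metric.ball x₀ ε := by
      rw [mem_ball_iff_norm] at hy ⊢
      have : (2 : ℝ) • y - x - x₀ = (2 : ℝ) • (y - (1 / 2 : ℝ) • (x + x₀)) := by module
      rw [this, norm_smul, Real.norm_ofNat]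
      linarith
    have := hlc.comp_line hf.nonneg (a := 1 / 2) (b := 1 / 2) (by norm_num) (by norm_num)
      (by norm_num) (hf.nonneg x) le_rfl hc.le (hball _ hz)
    have e : (1 / 2 : ℝ) • x + (1 / 2 : ℝ) • ((2 : ℝ) • y - x) = y := by module
    rwa [e] at this
  have h1 : s * V ≤ 1 := by
    rcases hs0.eq_or_lt with h0 | h0
    · rw [← h0, zero_mul]; exact zero_le_one
    refine le_trans ?_ (hf.measureReal_superlevel_le s)
    gcongr
    rw [hVdef, measureReal_def, measureReal_def]
    refine ENNReal.toReal_mono (hf.measure_superlevel_ne_top h0) ?_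
    refine le_trans (le_of_eq ?_) (measure_mono hsub)
    exact (Measure.addHaar_ball_center volume _ _).symm
  rw [le_div_iff₀ (by positivity)]
  calc f x * (V ^ 2 * c) = (s * V) ^ 2 := by rw [mul_pow, hss]; ring
    _ ≤ 1 := pow_le_one₀ (by positivity) h1

theorem IsLogConcave.le_apply_zero {g : E n → ℝ} (hlc : IsLogConcave g) (hg : ∀ x, 0 ≤ g x)
    (heven : ∀ x, g (-x) = g x) (x : E n) : g x ≤ g 0 := by
  have := hlc x (-x) (1 / 2) (1 / 2) (by norm_num) (by norm_num) (by norm_num)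
  rw [heven, ← Real.rpow_add_of_nonneg (hg x) (by norm_num) (by norm_num)] at this
  norm_num at this
  exact this

theorem IsProbabilityDensity.exists_ball_zero_le {g : E n → ℝ} (hg : IsProbabilityDensity g)
    (hlc : IsLogConcave g) (heven : ∀ x, g (-x) = g x) :
    ∃ ε > 0, ∃ c > 0, ∀ y ∈ Metric.ball (0 : E n) ε, c ≤ g y := by
  obtain ⟨x₀, ε, hε, c, hc, hball⟩ := hg.exists_ball_le hlc
  refine ⟨ε, hε, c, hc, fun y hy => ?_⟩
  rw [mem_ball_zero_iff] at hy
  -- `y` is the midpoint of `x₀ + y` and `-(x₀ - y)`, and evenness puts the second point in the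
  -- superlevel set.
  have h1 : x₀ + y ∈ {x | c ≤ g x} := hball _ (by simpa [mem_ball_iff_norm] using hy)
  have h2 : y - x₀ ∈ {x | c ≤ g x} := by
    have : c ≤ g (-(x₀ - y)) := by
      rw [heven]; exact hball _ (by simpa [mem_ball_iff_norm] using hy)
    simpa using this
  have := hlc.convex_superlevel hc h1 h2 (a := 1 / 2) (b := 1 / 2) (by norm_num) (by norm_num)
    (by norm_num)
  have e : (1 / 2 : ℝ) • (x₀ + y) + (1 / 2 : ℝ) • (y - x₀) = y := by module
  rwa [e] at this

/-- A long segment from `0` to `x`, together with the ball, forces many disjoint balls of radius `ε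
/ 2` into `L`; their number is bounded by a ratio of volumes. -/
theorem Convex.norm_le_of_ball_subset {L : Set (E n)} (hL : Convex ℝ L) {ε : ℝ} (hε : 0 < ε)
    (hball : Metric.ball 0 ε ⊆ L) (hfin : volume L ≠ ⊤) {x : E n} (hx : x ∈ L) :
    ‖x‖ ≤ 2 * ε * (volume.real L / volume.real (Metric.ball (0 : E n) (ε / 2)) + 1) := by
  have hV := measureReal_ball_pos (0 : E n) (half_pos hε)
  set V := volume.real (Metric.ball (0 : E n) (ε / 2)) with hVdef
  rcases eq_or_ne x 0 with rfl | hx0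
  · rw [norm_zero]; positivity
  set T := ‖x‖ with hT
  have hTpos : 0 < T := norm_pos_iff.2 hx0
  -- The centres `p k`, at distance `k * ε` from `0`, stay in the first half of the segment, where
  -- the convex hull of `x` and the `ε`-ball still has room for radius `ε / 2`.
  set m := ⌊T / (2 * ε)⌋₊ with hm
  have hmle : (m : ℝ) ≤ T / (2 * ε) := Nat.floor_le (by positivity)
  have hmlt : T / (2 * ε) < m + 1 := Nat.lt_floor_add_one _
  set p : ℕ → E n := fun k => (k * ε / T) • x with hp
  have hsub : ∀ k ∈ Finset.range m, Metric.ball (p k) (ε / 2) ⊆ L := by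
    intro k hk y hy
    have hkm : (k : ℝ) ≤ m := by exact_mod_cast (Finset.mem_range.1 hk).le
    set t := k * ε / T with ht
    have ht0 : 0 ≤ t := by positivity
    have ht1 : t ≤ 1 / 2 := by
      rw [ht, div_le_iff₀ hTpos]
      have := hkm.trans hmle
      rw [le_div_iff₀ (by positivity)] at this
      linarith
    have h1t : 0 < 1 - t := by linarith
    have hz : (1 - t)⁻¹ • (y - t • x) ∈ L := by
      apply hball
      rw [mem_ball_zero_iff, norm_smul, Real.norm_of_nonneg (inv_nonneg.2 h1t.le),
        inv_mul_lt_iff₀ h1t]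
      rw [mem_ball_iff_norm] at hy
      nlinarith
    have := hL hx hz ht0 h1t.le (by ring)
    rwa [smul_inv_smul₀ h1t.ne', add_sub_cancel] at this
  have hdisj : Set.PairwiseDisjoint (↑(Finset.range m)) fun k => Metric.ball (p k) (ε / 2) := by
    intro k _ l _ hkl
    apply Metric.ball_disjoint_ball
    rw [dist_eq_norm, hp]
    simp only
    rw [← sub_smul, norm_smul, ← hT, ← sub_div, ← sub_mul, norm_div, norm_mul,
      Real.norm_of_nonneg hTpos.le, div_mul_cancel₀ _ hTpos.ne', Real.norm_of_nonneg hε.le]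
    have : (1 : ℝ) ≤ ‖(k : ℝ) - l‖ := by
      rw [Real.norm_eq_abs]
      have h : (1 : ℤ) ≤ |(k : ℤ) - l| := Int.one_le_abs (sub_ne_zero.2 (by exact_mod_cast hkl))
      exact_mod_cast h
    nlinarith
  have h1 : m * V ≤ volume.real L := by
    have h2 : volume (⋃ k ∈ Finset.range m, Metric.ball (p k) (ε / 2)) ≤ volume L :=
      measure_mono (Set.iUnion₂_subset hsub)
    rw [measure_biUnion_finset hdisj fun k _ => measurableSet_ball] at h2
    simp_rw [Measure.addHaar_ball_center volume (p _)] at h2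
    rw [Finset.sum_const, Finset.card_range, nsmul_eq_mul] at h2
    have := ENNReal.toReal_mono hfin h2
    simpa [hVdef, measureReal_def] using this
  rw [← le_div_iff₀ hV] at h1
  rw [div_lt_iff₀ (by positivity)] at hmlt
  nlinarith

/-- For some `c < g 0` the set `{g ≥ c}` lies strictly inside radius `R`. Log-concavity along the
ray from `0` then makes `g` decay at the rate `α` determined by `g 0 * exp (-α R) = c`. The factor
`exp (α R)` in the constant covers `‖x‖ < R`, where `g ≤ g 0` is used. -/
theorem IsProbabilityDensity.exists_le_exp {g : E n → ℝ} (hg : IsProbabilityDensity g)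
    (hlc : IsLogConcave g) (heven : ∀ x, g (-x) = g x) :
    ∃ C > 0, ∃ α > 0, ∀ x, g x ≤ C * Real.exp (-(α * ‖x‖)) := by
  obtain ⟨ε, hε, c₀, hc₀, hball₀⟩ := hg.exists_ball_zero_le hlc heven
  have hg0 : 0 < g 0 := hc₀.trans_le (hball₀ 0 (Metric.mem_ball_self hε))
  obtain ⟨c, hc, hcc, hcg⟩ : ∃ c > 0, c ≤ c₀ ∧ c < g 0 :=
    ⟨min c₀ (g 0 / 2), by positivity, min_le_left _ _,
      (min_le_right _ _).trans_lt (half_lt_self hg0)⟩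
  obtain ⟨R, hR, hbound⟩ : ∃ R > 0, ∀ x, c ≤ g x → ‖x‖ < R := by
    have h := fun x hx => (hlc.convex_superlevel hc).norm_le_of_ball_subset hε
      (fun y hy => hcc.trans (hball₀ y hy)) (hg.measure_superlevel_ne_top hc) (x := x) hx
    refine ⟨_, ?_, fun x hx => (h x hx).trans_lt (lt_add_one _)⟩
    positivity
  set α := Real.log (g 0 / c) / R with hα
  have hαpos : 0 < α := div_pos (Real.log_pos ((one_lt_div hc).2 hcg)) hR
  have hαR : Real.exp (-(α * R)) = c / g 0 := by
    rw [hα, div_mul_cancel₀ _ hR.ne', Real.exp_neg, Real.exp_log (by positivity), inv_div]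
  refine ⟨g 0 * Real.exp (α * R), by positivity, α, hαpos, fun x => ?_⟩
  rcases lt_or_ge ‖x‖ R with hx | hx
  · calc g x ≤ g 0 * 1 := by rw [mul_one]; exact hlc.le_apply_zero hg.nonneg heven x
      _ ≤ g 0 * Real.exp (α * R + -(α * ‖x‖)) := by
        gcongr
        apply Real.one_le_exp
        nlinarith
      _ = _ := by rw [Real.exp_add]; ring
  · have hxpos : 0 < ‖x‖ := hR.trans_le hx
    have hle : g x ≤ g 0 * Real.exp (-(α * ‖x‖)) := by
      by_contra! hlt
      -- The point `s • x` has norm exactly `R`, yet log-concavity would give it a value at least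
      -- `c`.
      set s := R / ‖x‖ with hs
      have hs0 : 0 < s := by positivity
      have hs1 : s ≤ 1 := (div_le_one hxpos).2 hx
      have h1 := hlc.comp_line hg.nonneg (a := s) (b := 1 - s) (x := x) (y := 0) hs0.le
        (by linarith) (by ring) (by positivity) hlt.le hg0.le le_rfl
      rw [Real.mul_rpow hg0.le (Real.exp_pos _).le, ← Real.exp_mul, mul_right_comm,
        ← Real.rpow_add hg0, add_sub_cancel, Real.rpow_one, smul_zero, add_zero] at h1
      have e : -(α * ‖x‖) * s = -(α * R) := by rw [hs]; field_simp
      rw [e, hαR, mul_div_cancel₀ _ hg0.ne'] at h1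
      have h2 := hbound _ h1
      rw [norm_smul, Real.norm_of_nonneg hs0.le, hs, div_mul_cancel₀ _ hxpos.ne'] at h2
      exact lt_irrefl _ h2
    refine hle.trans ?_
    gcongr
    exact le_mul_of_one_le_right hg0.le (Real.one_le_exp (by positivity))

/-! ### The autocorrelation -/

theorem IsProbabilityDensity.integrable_mul_translate {f : E n → ℝ} (hf : IsProbabilityDensity f)
    (hlc : IsLogConcave f) (x : E n) : Integrable (fun y => f y * f (x + y)) volume := by
  obtain ⟨M, hM⟩ := hf.exists_le hlc
  refine hf.integrable.mul_bdd (c := M) ?_ (ae_of_all _ fun y => ?_)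
  · exact (hf.measurable.comp (measurable_const_add x)).aestronglyMeasurable
  · rw [Real.norm_of_nonneg (hf.nonneg _)]; exact hM _

theorem IsProbabilityDensity.ofReal_autocorrelation {f : E n → ℝ} (hf : IsProbabilityDensity f)
    (hlc : IsLogConcave f) (x : E n) : ENNReal.ofReal (autocorrelation f x) =
      ∫⁻ y, ENNReal.ofReal (f y) * ENNReal.ofReal (f (x + y)) := by
  rw [autocorrelation, ofReal_integral_eq_lintegral_ofReal (hf.integrable_mul_translate hlc x)
    (ae_of_all _ fun _ => mul_nonneg (hf.nonneg _) (hf.nonneg _))]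
  exact lintegral_congr fun y => ENNReal.ofReal_mul (hf.nonneg _)

theorem autocorrelation_nonneg {f : E n → ℝ} (hf : ∀ x, 0 ≤ f x) (x : E n) :
    0 ≤ autocorrelation f x :=
  integral_nonneg fun _ => mul_nonneg (hf _) (hf _)

theorem autocorrelation_neg (f : E n → ℝ) (x : E n) :
    autocorrelation f (-x) = autocorrelation f x := by
  rw [autocorrelation, ← integral_add_left_eq_self _ x, autocorrelation]
  refine integral_congr_ae (ae_of_all _ fun _ => ?_)
  simp [mul_comm]

theorem measurable_autocorrelation {f : E n → ℝ} (hf : Measurable f) :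
    Measurable (autocorrelation f) := by
  have : StronglyMeasurable (Function.uncurry fun x y : E n => f y * f (x + y)) :=
    ((hf.comp measurable_snd).mul (hf.comp (measurable_fst.add measurable_snd))).stronglyMeasurable
  exact this.integral_prod_right.measurable

theorem IsProbabilityDensity.lintegral_eq_one {f : E n → ℝ} (hf : IsProbabilityDensity f) :
    ∫⁻ x, ENNReal.ofReal (f x) = 1 := by
  rw [← ofReal_integral_eq_lintegral_ofReal hf.integrable (ae_of_all _ hf.nonneg),
    hf.integral_eq_one, ENNReal.ofReal_one]

theorem IsProbabilityDensity.autocorrelation {f : E n → ℝ} (hf : IsProbabilityDensity f)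
    (hlc : IsLogConcave f) : IsProbabilityDensity (autocorrelation f) := by
  have hmeas := measurable_autocorrelation hf.measurable
  have h0 := autocorrelation_nonneg hf.nonneg
  have h1 : ∫⁻ x, ENNReal.ofReal (_root_.autocorrelation f x) = 1 := by
    simp_rw [hf.ofReal_autocorrelation hlc]
    rw [lintegral_lintegral_swap]
    · have : ∀ y, ∫⁻ x, ENNReal.ofReal (f y) * ENNReal.ofReal (f (x + y)) =
          ENNReal.ofReal (f y) := by
        intro y
        rw [lintegral_const_mul _ (by have := hf.measurable; fun_prop),
          lintegral_add_right_eq_self (fun x => ENNReal.ofReal (f x)) y, hf.lintegral_eq_one,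
          mul_one]
      simp_rw [this, hf.lintegral_eq_one]
    · have := hf.measurable
      apply Measurable.aemeasurable
      simp only [Function.uncurry_def]
      fun_prop
  have hint : Integrable (_root_.autocorrelation f) volume := by
    refine ⟨hmeas.aestronglyMeasurable, ?_⟩
    rw [hasFiniteIntegral_iff_ofReal (ae_of_all _ h0), h1]
    exact ENNReal.one_lt_top
  refine ⟨hmeas, h0, hint, ?_⟩
  rw [integral_eq_lintegral_of_nonneg_ae (ae_of_all _ h0) hint.aestronglyMeasurable, h1,
    ENNReal.toReal_one]

/-- The integrand `f y * f (x + y)` is jointly log-concave in `(x, y)`; Prékopa–Leindler passes this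
to the marginal. The endpoint weights are separate because that inequality is stated for positive
weights. -/
theorem IsProbabilityDensity.isLogConcave_autocorrelation {f : E n → ℝ}
    (hf : IsProbabilityDensity f) (hlc : IsLogConcave f) : IsLogConcave (_root_.autocorrelation f) := by
  intro x y a b ha hb hab
  rcases ha.eq_or_lt with rfl | ha
  · obtain rfl : b = 1 := by linarith
    simp
  rcases hb.eq_or_lt with rfl | hb
  · obtain rfl : a = 1 := by linarith
    simp
  have h0 := autocorrelation_nonneg hf.nonneg
  rw [← ENNReal.ofReal_le_ofReal_iff (h0 _), ENNReal.ofReal_mul (Real.rpow_nonneg (h0 _) _),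
    ← ENNReal.ofReal_rpow_of_nonneg (h0 _) ha.le, ← ENNReal.ofReal_rpow_of_nonneg (h0 _) hb.le,
    hf.ofReal_autocorrelation hlc, hf.ofReal_autocorrelation hlc, hf.ofReal_autocorrelation hlc]
  have hm := hf.measurable
  refine prekopaLeindler_euclideanSpace n a b ha hb hab _ _ _ (by fun_prop) (by fun_prop)
    (by fun_prop) fun z w => ?_
  rw [← ENNReal.ofReal_mul (hf.nonneg _), ← ENNReal.ofReal_mul (hf.nonneg _),
    ← ENNReal.ofReal_mul (hf.nonneg _),
    ENNReal.ofReal_rpow_of_nonneg (mul_nonneg (hf.nonneg _) (hf.nonneg _)) ha.le,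
    ENNReal.ofReal_rpow_of_nonneg (mul_nonneg (hf.nonneg _) (hf.nonneg _)) hb.le,
    ← ENNReal.ofReal_mul (Real.rpow_nonneg (mul_nonneg (hf.nonneg _) (hf.nonneg _)) _)]
  apply ENNReal.ofReal_le_ofReal
  rw [Real.mul_rpow (hf.nonneg _) (hf.nonneg _), Real.mul_rpow (hf.nonneg _) (hf.nonneg _),
    mul_mul_mul_comm]
  have e : a • x + b • y + (a • z + b • w) = a • (x + z) + b • (y + w) := by module
  rw [e]
  exact mul_le_mul (hlc _ _ _ _ ha.le hb.le hab) (hlc _ _ _ _ ha.le hb.le hab)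
    (mul_nonneg (Real.rpow_nonneg (hf.nonneg _) _) (Real.rpow_nonneg (hf.nonneg _) _))
    (hf.nonneg _)

end LogConcave

/-! ### Ball's inequality on the half-line by transport of measure. -/

section RadialTransport

open Filter Topology Set

/-- `q` inverts the normalised primitive of `w`, so it pushes the uniform measure on `(0, 1)` to `w
/ A`. Off `U` the primitive has already reached its total `A`, hence every level `u * A` with `0 < u
< 1` is attained inside `U`, where the primitive is strictly increasing and differentiable. -/
theorem exists_quantile {w : ℝ → ℝ} {U : Set ℝ}
    (hint : IntegrableOn w (Ioi 0)) (hU : IsOpen U) (hconn : U.OrdConnected) (hU0 : U ⊆ Ioi 0)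
    (hpos : ∀ r ∈ U, 0 < w r) (hcont : ContinuousOn w U)
    (hzero : ∀ r, 0 < r → r ∉ U → ∀ s, r < s → w s = 0) (hA : 0 < ∫ r in Ioi 0, w r) :
    ∃ q : ℝ → ℝ, ∀ u ∈ Ioo (0 : ℝ) 1,
      q u ∈ U ∧ HasDerivAt q ((∫ r in Ioi 0, w r) / w (q u)) u := by
  set A := ∫ r in Ioi 0, w r with hAdef
  have hii : ∀ a b : ℝ, 0 ≤ a → 0 ≤ b → IntervalIntegrable w volume a b := by
    intro a b ha hb
    rw [intervalIntegrable_iff]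
    exact hint.mono_set fun x hx => (le_min ha hb).trans_lt hx.1
  set F : ℝ → ℝ := fun r => ∫ x in (0 : ℝ)..r, w x with hF
  have hFtop : Tendsto F atTop (𝓝 A) := intervalIntegral_tendsto_integral_Ioi 0 hint tendsto_id
  have hFcont : ∀ R, 0 ≤ R → ContinuousOn F (Icc 0 R) := by
    intro R hR
    have := intervalIntegral.continuousOn_primitive_interval' (hii 0 R le_rfl hR) (left_mem_uIcc)
    rwa [uIcc_of_le hR] at this
  have hFout : ∀ r, 0 < r → r ∉ U → F r = A := by
    intro r hr hrU
    have h1 : ∫ x in Ioi r, w x = 0 :=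
      setIntegral_eq_zero_of_forall_eq_zero fun x hx => hzero r hr hrU x hx
    rw [hAdef, ← intervalIntegral.integral_interval_add_Ioi hint
      (hint.mono_set (Ioi_subset_Ioi hr.le)), h1, add_zero]
  have hFmono : StrictMonoOn F U := by
    intro r hr s hs hrs
    have hr0 : 0 < r := hU0 hr
    have hs0 : 0 < s := hU0 hs
    have h1 : F s - F r = ∫ x in r..s, w x :=
      intervalIntegral.integral_interval_sub_left (hii 0 s le_rfl hs0.le) (hii 0 r le_rfl hr0.le)
    have h2 : 0 < ∫ x in r..s, w x :=
      intervalIntegral.intervalIntegral_pos_of_pos_on (hii r s hr0.le hs0.le)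
        (fun x hx => hpos x (hconn.out hr hs ⟨hx.1.le, hx.2.le⟩)) hrs
    linarith
  have hsurj : ∀ u ∈ Ioo (0 : ℝ) 1, ∃ r ∈ U, F r = u * A := by
    intro u hu
    have huA : u * A < A := by nlinarith [hu.2]
    obtain ⟨R, hRu, hR0⟩ := ((hFtop.eventually_const_lt huA).and (eventually_ge_atTop 0)).exists
    have hF0 : F 0 = 0 := intervalIntegral.integral_same
    obtain ⟨r, hr, hFr⟩ := intermediate_value_Icc hR0 (hFcont R hR0)
      (show u * A ∈ Icc (F 0) (F R) from ⟨by rw [hF0]; exact (mul_pos hu.1 hA).le, hRu.le⟩)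
    have hr0 : 0 < r := by
      refine lt_of_le_of_ne hr.1 ?_
      rintro rfl
      rw [hF0] at hFr
      exact (mul_pos hu.1 hA).ne hFr
    refine ⟨r, ?_, hFr⟩
    by_contra hrU
    rw [hFout r hr0 hrU] at hFr
    exact huA.ne' hFr
  refine ⟨fun u => Function.invFunOn F U (u * A), fun u hu => ?_⟩
  have hq := Function.invFunOn_mem (hsurj u hu)
  have hFq := Function.invFunOn_eq (hsurj u hu)
  set r := Function.invFunOn F U (u * A) with hr
  refine ⟨hq, ?_⟩
  have hr0 : 0 < r := hU0 hq
  have h1 : HasStrictDerivAt F (w r) r := by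
    refine intervalIntegral.integral_hasStrictDerivAt_right (hii 0 r le_rfl hr0.le) ?_
      (hcont.continuousAt (hU.mem_nhds hq))
    exact ⟨Ioi 0, Ioi_mem_nhds hr0, hint.aestronglyMeasurable⟩
  have h2 : HasStrictDerivAt (fun x => F x / A) (w r / A) r := h1.div_const A
  have h3 := h2.to_local_left_inverse (div_pos (hpos r hq) hA).ne'
    (g := fun u => Function.invFunOn F U (u * A)) (by
      filter_upwards [hU.mem_nhds hq] with x hx
      rw [div_mul_cancel₀ _ hA.ne']
      exact hFmono.injOn.leftInvOn_invFunOn hx)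
  rw [inv_div, hFq, mul_div_cancel_right₀ _ hA.ne'] at h3
  exact h3.hasDerivAt

/-- A nonnegative function on the positive half-line which is decreasing, log-concave, and whose
`p`-th radial moment is finite. -/
structure IsRadialProfile (p : ℝ) (φ : ℝ → ℝ) : Prop where
  nonneg : ∀ r, 0 < r → 0 ≤ φ r
  antitone : AntitoneOn φ (Ioi 0)
  logConcave : ∀ r s a b : ℝ, 0 < r → 0 < s → 0 ≤ a → 0 ≤ b → a + b = 1 →
    φ r ^ a * φ s ^ b ≤ φ (a * r + b * s)
  integrableOn : IntegrableOn (fun r => r ^ (p - 1) * φ r) (Ioi 0)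

theorem IsRadialProfile.exists_quantile {p : ℝ} {φ : ℝ → ℝ} (hφ : IsRadialProfile p φ)
    (hA : 0 < ∫ r in Ioi 0, r ^ (p - 1) * φ r) :
    ∃ q : ℝ → ℝ, ∀ u ∈ Ioo (0 : ℝ) 1, 0 < q u ∧ 0 < φ (q u) ∧
      HasDerivAt q ((∫ r in Ioi 0, r ^ (p - 1) * φ r) / (q u ^ (p - 1) * φ (q u))) u := by
  -- Requiring positivity at a later point drops the right endpoint of the support, where `φ` may
  -- jump. On this open interval `log φ` is concave, hence continuous.
  set U : Set ℝ := {r | 0 < r ∧ ∃ s, r < s ∧ 0 < φ s} with hU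
  have hUpos : ∀ r ∈ U, 0 < φ r := by
    rintro r ⟨hr, s, hrs, hs⟩
    exact hs.trans_le (hφ.antitone hr (hr.trans hrs) hrs.le)
  have hUopen : IsOpen U := by
    have : U = ⋃ s ∈ {s | 0 < φ s}, Ioo 0 s := by
      ext r
      simp only [hU, mem_ofPred_eq, mem_iUnion, mem_Ioo, exists_prop]
      tauto
    rw [this]
    exact isOpen_biUnion fun s _ => isOpen_Ioo
  have hUconn : U.OrdConnected := by
    constructor
    rintro r ⟨hr, -⟩ s ⟨-, s', hs', hp⟩ x hx
    exact ⟨hr.trans_le hx.1, s', hx.2.trans_lt hs', hp⟩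
  have hconc : ConcaveOn ℝ U (fun r => Real.log (φ r)) := by
    refine ⟨hUconn.convex, fun r hr s hs a b ha hb hab => ?_⟩
    have h1 := hφ.logConcave r s a b hr.1 hs.1 ha hb hab
    have hr' := hUpos r hr
    have hs' := hUpos s hs
    have h2 := Real.log_le_log (by positivity) h1
    rw [Real.log_mul (by positivity) (by positivity), Real.log_rpow hr', Real.log_rpow hs'] at h2
    exact h2
  have hφc : ContinuousOn φ U := by
    refine ((hconc.continuousOn hUopen).rexp).congr fun r hr => ?_
    exact (Real.exp_log (hUpos r hr)).symm
  obtain ⟨q, hq⟩ := _root_.exists_quantile (w := fun r => r ^ (p - 1) * φ r) (U := U)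
    hφ.integrableOn hUopen hUconn (fun r hr => hr.1) (fun r hr => mul_pos (Real.rpow_pos_of_pos hr.1 _) (hUpos r hr))
    (ContinuousOn.mul (continuousOn_id.rpow_const fun r hr => Or.inl hr.1.ne') hφc)
    (fun r hr hrU s hrs => by
      have : φ s = 0 := by
        by_contra h
        exact hrU ⟨hr, s, hrs, lt_of_le_of_ne (hφ.nonneg s (hr.trans hrs)) (Ne.symm h)⟩
      rw [this, mul_zero]) hA
  exact ⟨q, fun u hu => ⟨(hq u hu).1.1, hUpos _ (hq u hu).1, (hq u hu).2⟩⟩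

/-- With `l = a s / D`, `k = b r / D` and `t = r s / D`, the quantity becomes `(l A / (r^p x) + k B
/ (s^p y)) * t^p z`. Two uses of the weighted AM–GM inequality suffice: one on the bracket, the
other giving `r^l s^k ≤ l r + k s = t`; then all powers cancel. -/
theorem one_le_transport_jacobian {p a b r s A B x y z : ℝ} (hp : 0 < p) (ha : 0 < a) (hb : 0 < b)
    (hab : a + b = 1) (hr : 0 < r) (hs : 0 < s) (hA : 1 ≤ A) (hB : 1 ≤ B) (hx : 0 < x)
    (hy : 0 < y)
    (h : x ^ (a * s / (a * s + b * r)) * y ^ (b * r / (a * s + b * r)) ≤ z) :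
    1 ≤ (a * s ^ 2 * (A / (r ^ (p - 1) * x)) + b * r ^ 2 * (B / (s ^ (p - 1) * y))) /
        (a * s + b * r) ^ 2 * ((r * s / (a * s + b * r)) ^ (p - 1) * z) := by
  set D := a * s + b * r with hD
  have hDpos : 0 < D := by positivity
  set t := r * s / D with ht
  have htpos : 0 < t := by positivity
  set l := a * s / D with hl
  set k := b * r / D with hk
  have hl0 : 0 ≤ l := by positivity
  have hk0 : 0 ≤ k := by positivity
  have hlk : l + k = 1 := by rw [hl, hk, ← add_div, div_self hDpos.ne']
  have e1 : r ^ (p - 1) = r ^ p / r := by rw [Real.rpow_sub_one hr.ne']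
  have e2 : s ^ (p - 1) = s ^ p / s := by rw [Real.rpow_sub_one hs.ne']
  have e3 : t ^ (p - 1) = t ^ p / t := by rw [Real.rpow_sub_one htpos.ne']
  have hrp : 0 < r ^ p := Real.rpow_pos_of_pos hr p
  have hsp : 0 < s ^ p := Real.rpow_pos_of_pos hs p
  have htp : 0 < t ^ p := Real.rpow_pos_of_pos htpos p
  have hJ : (a * s ^ 2 * (A / (r ^ (p - 1) * x)) + b * r ^ 2 * (B / (s ^ (p - 1) * y))) / D ^ 2 *
      (t ^ (p - 1) * z) = (l * (A / (r ^ p * x)) + k * (B / (s ^ p * y))) * (t ^ p * z) := by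
    rw [e1, e2, e3]
    generalize t ^ p = T
    rw [ht, hl, hk]
    field_simp
  rw [hJ]
  have hX : 0 < (r ^ p * x)⁻¹ := by positivity
  have hY : 0 < (s ^ p * y)⁻¹ := by positivity
  have h1 : ((r ^ p * x)⁻¹) ^ l * ((s ^ p * y)⁻¹) ^ k ≤ l * (A / (r ^ p * x)) + k * (B / (s ^ p * y)) := by
    refine (Real.geom_mean_le_arith_mean2_weighted hl0 hk0 hX.le hY.le hlk).trans ?_
    rw [div_eq_mul_inv, div_eq_mul_inv]
    have := le_mul_of_one_le_left hX.le hA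
    have := le_mul_of_one_le_left hY.le hB
    gcongr
  have h2 : r ^ l * s ^ k ≤ t := by
    refine (Real.geom_mean_le_arith_mean2_weighted hl0 hk0 hr.le hs.le hlk).trans (le_of_eq ?_)
    rw [hl, hk, ht]
    field_simp
    rw [hab]
  have h3 : ((r ^ p * x)⁻¹) ^ l * ((s ^ p * y)⁻¹) ^ k * (x ^ l * y ^ k) = ((r ^ l * s ^ k) ^ p)⁻¹ := by
    rw [Real.inv_rpow (by positivity), Real.inv_rpow (by positivity),
      Real.mul_rpow hrp.le hx.le, Real.mul_rpow hsp.le hy.le,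
      Real.mul_rpow (Real.rpow_nonneg hr.le _) (Real.rpow_nonneg hs.le _),
      ← Real.rpow_mul hr.le, ← Real.rpow_mul hs.le, ← Real.rpow_mul hr.le, ← Real.rpow_mul hs.le,
      mul_comm p l, mul_comm p k]
    have := Real.rpow_pos_of_pos hx l
    have := Real.rpow_pos_of_pos hy k
    field_simp
  have hrs : 0 < r ^ l * s ^ k := mul_pos (Real.rpow_pos_of_pos hr _) (Real.rpow_pos_of_pos hs _)
  have hxy : 0 < x ^ l * y ^ k := mul_pos (Real.rpow_pos_of_pos hx _) (Real.rpow_pos_of_pos hy _)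
  have hXY : 0 < ((r ^ p * x)⁻¹) ^ l * ((s ^ p * y)⁻¹) ^ k :=
    mul_pos (Real.rpow_pos_of_pos hX _) (Real.rpow_pos_of_pos hY _)
  calc (1 : ℝ) = ((r ^ l * s ^ k) ^ p)⁻¹ * (r ^ l * s ^ k) ^ p :=
        (inv_mul_cancel₀ (Real.rpow_pos_of_pos hrs p).ne').symm
    _ ≤ ((r ^ l * s ^ k) ^ p)⁻¹ * t ^ p := by gcongr
    _ = ((r ^ p * x)⁻¹) ^ l * ((s ^ p * y)⁻¹) ^ k * (t ^ p * (x ^ l * y ^ k)) := by rw [← h3]; ring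
    _ ≤ (l * (A / (r ^ p * x)) + k * (B / (s ^ p * y))) * (t ^ p * z) := by
      gcongr

/-- Ball's inequality for radial moments of three functions on the positive half-line. -/
theorem IsRadialProfile.one_le_lintegral {p a b : ℝ} (hp : 0 < p) (ha : 0 < a) (hb : 0 < b)
    (hab : a + b = 1) {φ ψ h : ℝ → ℝ} (hφ : IsRadialProfile p φ) (hψ : IsRadialProfile p ψ)
    (hA : 1 ≤ ∫ r in Ioi 0, r ^ (p - 1) * φ r) (hB : 1 ≤ ∫ r in Ioi 0, r ^ (p - 1) * ψ r)
    (hh : ∀ r s, 0 < r → 0 < s →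
      φ r ^ (a * s / (a * s + b * r)) * ψ s ^ (b * r / (a * s + b * r)) ≤
        h (r * s / (a * s + b * r))) :
    1 ≤ ∫⁻ t in Ioi (0 : ℝ), ENNReal.ofReal (t ^ (p - 1) * h t) := by
  obtain ⟨q, hq⟩ := hφ.exists_quantile (zero_lt_one.trans_le hA)
  obtain ⟨q', hq'⟩ := hψ.exists_quantile (zero_lt_one.trans_le hB)
  set A := ∫ r in Ioi 0, r ^ (p - 1) * φ r
  set B := ∫ r in Ioi 0, r ^ (p - 1) * ψ r
  -- The weighted harmonic mean `1 / T = a / q + b / q'`, matching the argument of `h` in `hh`.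
  -- Changing variables by `T` leaves an integrand that is at least `1` on `(0, 1)`.
  set T : ℝ → ℝ := fun u => q u * q' u / (a * q' u + b * q u) with hT
  set T' : ℝ → ℝ := fun u => (a * q' u ^ 2 * (A / (q u ^ (p - 1) * φ (q u))) +
    b * q u ^ 2 * (B / (q' u ^ (p - 1) * ψ (q' u)))) / (a * q' u + b * q u) ^ 2 with hT'
  have hder : ∀ u ∈ Ioo (0 : ℝ) 1, HasDerivAt T (T' u) u := by
    intro u hu
    obtain ⟨h1, h2, h3⟩ := hq u hu
    obtain ⟨h1', h2', h3'⟩ := hq' u hu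
    have hD : a * q' u + b * q u ≠ 0 := by positivity
    have := (h3.mul h3').div ((h3'.const_mul a).add (h3.const_mul b)) hD
    refine HasDerivAt.congr_deriv (f := T) this ?_
    simp only [hT', Pi.mul_apply, Pi.add_apply]
    congr 1
    ring
  have hT'pos : ∀ u ∈ Ioo (0 : ℝ) 1, 0 < T' u := by
    intro u hu
    obtain ⟨h1, h2, h3⟩ := hq u hu
    obtain ⟨h1', h2', h3'⟩ := hq' u hu
    have := Real.rpow_pos_of_pos h1 (p - 1)
    have := Real.rpow_pos_of_pos h1' (p - 1)
    have : 0 < A := zero_lt_one.trans_le hA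
    have : 0 < B := zero_lt_one.trans_le hB
    simp only [hT']
    positivity
  have hinj : InjOn T (Ioo 0 1) := by
    refine (strictMonoOn_of_deriv_pos (convex_Ioo 0 1)
      (fun u hu => (hder u hu).continuousAt.continuousWithinAt) fun u hu => ?_).injOn
    rw [interior_Ioo] at hu
    rw [(hder u hu).deriv]
    exact hT'pos u hu
  have himg : T '' Ioo 0 1 ⊆ Ioi 0 := by
    rintro _ ⟨u, hu, rfl⟩
    obtain ⟨h1, h2, h3⟩ := hq u hu
    obtain ⟨h1', h2', h3'⟩ := hq' u hu
    simp only [hT, mem_Ioi]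
    positivity
  refine le_trans ?_ (lintegral_mono_set himg)
  rw [lintegral_image_eq_lintegral_abs_deriv_mul measurableSet_Ioo
    (fun u hu => (hder u hu).hasDerivWithinAt) hinj]
  calc (1 : ℝ≥0∞) = ∫⁻ _ in Ioo (0 : ℝ) 1, 1 := by simp
    _ ≤ _ := setLIntegral_mono' measurableSet_Ioo fun u hu => ?_
  obtain ⟨h1, h2, h3⟩ := hq u hu
  obtain ⟨h1', h2', h3'⟩ := hq' u hu
  rw [← ENNReal.ofReal_mul (abs_nonneg _), abs_of_pos (hT'pos u hu), ← ENNReal.ofReal_one]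
  exact ENNReal.ofReal_le_ofReal
    (one_le_transport_jacobian hp ha hb hab h1 h1' hA hB h2 h2' (hh _ _ h1 h1'))

end RadialTransport

/-! ### Sets given by radial functions, and convexity of Ball bodies. -/

section Bodies

open Set

variable {n : ℕ}

theorem E.exists_norm_eq_one (hn : 1 ≤ n) : ∃ v : E n, ‖v‖ = 1 :=
  ⟨EuclideanSpace.single ⟨0, hn⟩ 1, by simp⟩

/-- The origin is listed apart because `‖0‖⁻¹ • 0 = 0` is not a unit vector; it belongs to the set
as soon as some unit vector exists, hence `1 ≤ n`. -/
theorem mem_bodyOfRadial_iff (hn : 1 ≤ n) {ρ : E n → ℝ≥0∞} {x : E n} :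
    x ∈ bodyOfRadial ρ ↔ x = 0 ∨ ENNReal.ofReal ‖x‖ ≤ ρ (‖x‖⁻¹ • x) := by
  constructor
  · rintro ⟨v, hv, r, hr, rfl⟩
    rcases eq_or_ne r 0 with rfl | hr0
    · left; simp
    · right
      have hr1 : (r : ℝ) ≠ 0 := by exact_mod_cast hr0
      rw [norm_smul, hv, mul_one, Real.norm_of_nonneg r.coe_nonneg, inv_smul_smul₀ hr1]
      simpa using hr
  · rintro (rfl | h)
    · obtain ⟨v, hv⟩ := E.exists_norm_eq_one hn
      exact ⟨v, hv, 0, by simp, by simp⟩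
    · rcases eq_or_ne x 0 with rfl | hx
      · obtain ⟨v, hv⟩ := E.exists_norm_eq_one hn
        exact ⟨v, hv, 0, by simp, by simp⟩
      have hx' : ‖x‖ ≠ 0 := norm_ne_zero_iff.2 hx
      refine ⟨‖x‖⁻¹ • x, by rw [norm_smul, norm_inv, norm_norm, inv_mul_cancel₀ hx'], ‖x‖₊, ?_,
        by simp [smul_inv_smul₀ hx']⟩
      rw [ofReal_norm] at h
      exact h

theorem bodyOfRadial_congr {ρ ρ' : E n → ℝ≥0∞} (h : ∀ v, ‖v‖ = 1 → ρ v = ρ' v) :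
    bodyOfRadial ρ = bodyOfRadial ρ' := by
  ext x
  constructor
  · rintro ⟨v, hv, r, hr, rfl⟩
    exact ⟨v, hv, r, h v hv ▸ hr, rfl⟩
  · rintro ⟨v, hv, r, hr, rfl⟩
    exact ⟨v, hv, r, h v hv ▸ hr, rfl⟩

theorem smul_bodyOfRadial {c : ℝ} (hc : 0 < c) (ρ : E n → ℝ≥0∞) :
    c • bodyOfRadial ρ = bodyOfRadial fun v => ENNReal.ofReal c * ρ v := by
  have hc' : ENNReal.ofReal c ≠ 0 := by simpa using hc
  ext x
  constructor
  · rintro ⟨_, ⟨v, hv, r, hr, rfl⟩, rfl⟩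
    refine ⟨v, hv, c.toNNReal * r, ?_, ?_⟩
    · rw [ENNReal.coe_mul]; exact mul_le_mul_right hr _
    · simp [hc.le, smul_smul]
  · rintro ⟨v, hv, r, hr, rfl⟩
    refine ⟨(c⁻¹ * r) • v, ⟨v, hv, c⁻¹.toNNReal * r, ?_, ?_⟩, ?_⟩
    · rw [ENNReal.coe_mul, ← ENNReal.ofReal, ENNReal.ofReal_inv_of_pos hc,
        ← ENNReal.div_eq_inv_mul]
      refine ENNReal.div_le_of_le_mul ?_
      rwa [mul_comm]
    · simp [hc.le]
    · simp [smul_smul, hc.ne']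

/-- No continuity of `ρ` is assumed: closedness follows from convexity, since the open segment from
the interior point `0` to a point of the closure lies in the interior. -/
theorem isSymmetricConvexBody_bodyOfRadial (hn : 1 ≤ n) {ρ : E n → ℝ≥0∞} {m M : ℝ≥0∞}
    (hm : m ≠ 0) (hM : M ≠ ⊤) (hmρ : ∀ v, ‖v‖ = 1 → m ≤ ρ v) (hρM : ∀ v, ‖v‖ = 1 → ρ v ≤ M)
    (heven : ∀ v, ρ (-v) = ρ v) (hconv : Convex ℝ (bodyOfRadial ρ)) :
    IsSymmetricConvexBody (bodyOfRadial ρ) := by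
  have hunit : ∀ x : E n, x ≠ 0 → ‖‖x‖⁻¹ • x‖ = 1 := by
    intro x hx
    rw [norm_smul, norm_inv, norm_norm, inv_mul_cancel₀ (norm_ne_zero_iff.2 hx)]
  have hmt : m ≠ ⊤ := by
    obtain ⟨v, hv⟩ := E.exists_norm_eq_one hn
    exact ne_top_of_le_ne_top hM ((hmρ v hv).trans (hρM v hv))
  have hball : Metric.ball 0 m.toReal ⊆ bodyOfRadial ρ := by
    intro x hx
    rw [mem_bodyOfRadial_iff hn]
    rcases eq_or_ne x 0 with rfl | hx0
    · exact Or.inl rfl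
    · right
      rw [mem_ball_zero_iff] at hx
      exact (ENNReal.ofReal_le_of_le_toReal hx.le).trans (hmρ _ (hunit x hx0))
  have h0 : (0 : E n) ∈ interior (bodyOfRadial ρ) :=
    interior_maximal hball Metric.isOpen_ball
      (Metric.mem_ball_self (ENNReal.toReal_pos hm hmt))
  have hclosed : IsClosed (bodyOfRadial ρ) := by
    refine isClosed_of_closure_subset fun x hx => ?_
    rw [mem_bodyOfRadial_iff hn]
    rcases eq_or_ne x 0 with rfl | hx0
    · exact Or.inl rfl
    right
    have hxpos : 0 < ‖x‖ := norm_pos_iff.2 hx0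
    have hfin : ρ (‖x‖⁻¹ • x) ≠ ⊤ := ne_top_of_le_ne_top hM (hρM _ (hunit x hx0))
    refine ENNReal.ofReal_le_of_le_toReal ?_
    set R := (ρ (‖x‖⁻¹ • x)).toReal with hR
    by_contra! hlt
    have hR0 : 0 ≤ R := ENNReal.toReal_nonneg
    -- `t • x` has norm halfway between `R` and `‖x‖`, so it lies on the segment but beyond the
    -- radial bound.
    set t := (R + ‖x‖) / 2 / ‖x‖ with ht
    have ht0 : 0 < t := by positivity
    have ht1 : t < 1 := by rw [ht, div_lt_one hxpos]; linarith
    have hmem : t • x ∈ bodyOfRadial ρ := by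
      refine interior_subset (hconv.openSegment_interior_closure_subset_interior h0 hx ?_)
      exact ⟨1 - t, t, by linarith, ht0, by ring, by simp⟩
    rw [mem_bodyOfRadial_iff hn] at hmem
    rcases hmem with h | h
    · exact (smul_ne_zero ht0.ne' hx0) h
    · rw [norm_smul, Real.norm_of_nonneg ht0.le, smul_smul] at h
      have e : (t * ‖x‖)⁻¹ * t = ‖x‖⁻¹ := by field_simp
      rw [e, ENNReal.ofReal_le_iff_le_toReal hfin, ← hR, ht, div_mul_cancel₀ _ hxpos.ne'] at h
      linarith
  have hbdd : Bornology.IsBounded (bodyOfRadial ρ) := by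
    refine (Metric.isBounded_closedBall (x := (0 : E n)) (r := M.toReal)).subset ?_
    rintro _ ⟨v, hv, r, hr, rfl⟩
    rw [mem_closedBall_zero_iff, norm_smul, hv, mul_one, Real.norm_of_nonneg r.coe_nonneg]
    exact ENNReal.toReal_mono hM (hr.trans (hρM v hv))
  refine ⟨hconv, Metric.isCompact_of_isClosed_isBounded hclosed hbdd, ⟨0, h0⟩, ?_⟩
  rintro _ ⟨v, hv, r, hr, rfl⟩
  exact ⟨-v, by rwa [norm_neg], r, by rwa [heven], by simp⟩

theorem lintegral_Ioi_comp_mul_left {c : ℝ} (hc : 0 < c) (F : ℝ → ℝ≥0∞) :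
    ∫⁻ r in Ioi (0 : ℝ), F r = ENNReal.ofReal c * ∫⁻ r in Ioi (0 : ℝ), F (c * r) := by
  have himg : (fun r => c * r) '' Ioi 0 = Ioi 0 := by
    ext r
    constructor
    · rintro ⟨s, hs, rfl⟩
      exact mul_pos hc hs
    · intro hr
      exact ⟨c⁻¹ * r, mul_pos (inv_pos.2 hc) hr, mul_inv_cancel_left₀ hc.ne' r⟩
  have h := lintegral_image_eq_lintegral_abs_deriv_mul (s := Ioi (0 : ℝ)) (f := fun r => c * r)
    (f' := fun _ => c) measurableSet_Ioi
    (fun x _ => by simpa using ((hasDerivAt_id x).const_mul c).hasDerivWithinAt)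
    (fun x _ y _ hxy => mul_left_cancel₀ hc.ne' hxy) F
  rw [himg] at h
  rw [h, lintegral_const_mul' _ _ ENNReal.ofReal_ne_top, abs_of_pos hc]

/-- The `p`-th radial moment of `g` along the ray through `x`. -/
noncomputable def radialMoment (p : ℝ) (g : E n → ℝ) (x : E n) : ℝ≥0∞ :=
  ∫⁻ r in Ioi (0 : ℝ), ENNReal.ofReal (r ^ (p - 1) * g (r • x))

theorem radialMoment_smul {p c : ℝ} (hc : 0 < c) (g : E n → ℝ) (x : E n) :
    radialMoment p g x = ENNReal.ofReal (c ^ p) * radialMoment p g (c • x) := by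
  have hcp : c ^ p = c * c ^ (p - 1) := by rw [Real.rpow_sub_one hc.ne']; field_simp
  rw [radialMoment, lintegral_Ioi_comp_mul_left hc, radialMoment, hcp, ENNReal.ofReal_mul hc.le, mul_assoc,
    ← lintegral_const_mul' (ENNReal.ofReal (c ^ (p - 1))) _ ENNReal.ofReal_ne_top]
  congr 1
  refine setLIntegral_congr_fun measurableSet_Ioi fun r hr => ?_
  rw [← ENNReal.ofReal_mul (Real.rpow_nonneg hc.le _), Real.mul_rpow hc.le (le_of_lt hr),
    smul_smul, mul_comm r c, mul_assoc]

/-- The moment is homogeneous of degree `-p`, which absorbs `‖x‖` into its argument. -/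
theorem mem_ballBody_iff (hn : 1 ≤ n) {p : ℝ} (hp : 0 < p) {g : E n → ℝ} {x : E n} :
    x ∈ ballBody p g ↔ x = 0 ∨ 1 ≤ radialMoment p g x := by
  rw [ballBody, mem_bodyOfRadial_iff hn]
  refine or_congr_right' fun hx => ?_
  have hx' : 0 < ‖x‖ := norm_pos_iff.2 hx
  change _ ≤ (radialMoment p g (‖x‖⁻¹ • x)) ^ (1 / p) ↔ _
  have h1 := radialMoment_smul (p := p) (inv_pos.2 hx') g x
  have hpos : 0 < ‖x‖ ^ p := Real.rpow_pos_of_pos hx' p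
  rw [h1, Real.inv_rpow hx'.le, ENNReal.ofReal_inv_of_pos hpos, ← ENNReal.div_eq_inv_mul,
    ENNReal.le_div_iff_mul_le (Or.inl (by simpa using hpos)) (Or.inl ENNReal.ofReal_ne_top), one_mul,
    ← ENNReal.ofReal_rpow_of_pos hx', one_div, ENNReal.le_rpow_inv_iff hp]

theorem IsLogConcave.antitoneOn_ray {g : E n → ℝ} (hlc : IsLogConcave g) (hg : ∀ x, 0 ≤ g x)
    (heven : ∀ x, g (-x) = g x) (x : E n) : AntitoneOn (fun r : ℝ => g (r • x)) (Ioi 0) := by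
  intro r hr s hs hrs
  have hr0 : 0 < r := hr
  have hs0 : 0 < s := hs
  -- `r • x` is a convex combination of `± s • x`, where `g` takes equal values.
  have h := hlc (s • x) (-(s • x)) ((s + r) / (2 * s)) ((s - r) / (2 * s)) (by positivity)
    (div_nonneg (by linarith) (by positivity)) (by field_simp; ring)
  have e : ((s + r) / (2 * s)) • s • x + ((s - r) / (2 * s)) • -(s • x) = r • x := by
    rw [smul_neg, ← sub_eq_add_neg, ← sub_smul, smul_smul]
    congr 1
    field_simp
    ring
  rw [e, heven, ← Real.rpow_add_of_nonneg (hg _) (by positivity)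
    (div_nonneg (by linarith) (by positivity))] at h
  have e2 : (s + r) / (2 * s) + (s - r) / (2 * s) = 1 := by field_simp; ring
  rwa [e2, Real.rpow_one] at h

theorem IsLogConcave.isRadialProfile {g : E n → ℝ} (hlc : IsLogConcave g) (hg : ∀ x, 0 ≤ g x)
    (heven : ∀ x, g (-x) = g x) {p : ℝ} {x : E n} (hfin : radialMoment p g x ≠ ⊤) :
    IsRadialProfile p (fun r => g (r • x)) where
  nonneg r _ := hg _
  antitone := hlc.antitoneOn_ray hg heven x
  logConcave r s a b _ _ ha hb hab := by
    have := hlc (r • x) (s • x) a b ha hb hab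
    rwa [smul_smul, smul_smul, ← add_smul] at this
  integrableOn := by
    refine ⟨?_, ?_⟩
    · refine AEMeasurable.aestronglyMeasurable ?_
      refine AEMeasurable.mul (by fun_prop) ?_
      exact aemeasurable_restrict_of_antitoneOn measurableSet_Ioi
        (hlc.antitoneOn_ray hg heven x)
    · rw [hasFiniteIntegral_iff_ofReal]
      · exact lt_top_iff_ne_top.2 hfin
      · filter_upwards [ae_restrict_mem measurableSet_Ioi] with r hr
        exact mul_nonneg (Real.rpow_nonneg (le_of_lt hr) _) (hg _)

theorem IsLogConcave.one_le_radialMoment {g : E n → ℝ} (hlc : IsLogConcave g)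
    (hg : ∀ x, 0 ≤ g x) (heven : ∀ x, g (-x) = g x) {p : ℝ} (hp : 0 < p) {x y : E n}
    (hx : radialMoment p g x ≠ ⊤) (hy : radialMoment p g y ≠ ⊤) (hx1 : 1 ≤ radialMoment p g x)
    (hy1 : 1 ≤ radialMoment p g y) {a b : ℝ} (ha : 0 < a) (hb : 0 < b) (hab : a + b = 1) :
    1 ≤ radialMoment p g (a • x + b • y) := by
  have hone : ∀ z : E n, radialMoment p g z ≠ ⊤ → 1 ≤ radialMoment p g z →
      1 ≤ ∫ r in Ioi (0 : ℝ), r ^ (p - 1) * g (r • z) := by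
    intro z hz hz1
    have hprof := hlc.isRadialProfile hg heven hz
    have h0 : 0 ≤ᵐ[volume.restrict (Ioi 0)] fun r : ℝ => r ^ (p - 1) * g (r • z) := by
      filter_upwards [ae_restrict_mem measurableSet_Ioi] with r hr
      exact mul_nonneg (Real.rpow_nonneg (le_of_lt hr) _) (hg _)
    rw [integral_eq_lintegral_of_nonneg_ae h0 hprof.integrableOn.aestronglyMeasurable,
      ← ENNReal.toReal_one]
    exact ENNReal.toReal_mono hz hz1
  refine (hlc.isRadialProfile hg heven hx).one_le_lintegral hp ha hb hab
    (hlc.isRadialProfile hg heven hy) (hone x hx hx1) (hone y hy hy1)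
    (h := fun t => g (t • (a • x + b • y))) fun r s hr hs => ?_
  -- The ray through `a • x + b • y` meets the segment from `r • x` to `s • y` at parameter `r s /
  -- (a s + b r)`, with weights `a s / (a s + b r)` and `b r / (a s + b r)`.
  have hD : 0 < a * s + b * r := by positivity
  refine (hlc (r • x) (s • y) _ _ (by positivity) (by positivity)
    (by rw [← add_div, div_self hD.ne'])).trans (le_of_eq ?_)
  congr 1
  rw [smul_add, smul_smul, smul_smul, smul_smul, smul_smul]
  congr 2 <;> ring

theorem convex_ballBody (hn : 1 ≤ n) {p : ℝ} (hp : 0 < p) {g : E n → ℝ} (hlc : IsLogConcave g)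
    (hg : ∀ x, 0 ≤ g x) (heven : ∀ x, g (-x) = g x)
    (hfin : ∀ x, x ≠ 0 → radialMoment p g x ≠ ⊤) : Convex ℝ (ballBody p g) := by
  -- Star-shapedness settles the case of an endpoint at `0`, where the moment is not known to be
  -- finite.
  have hstar : ∀ x ∈ ballBody p g, ∀ c : ℝ, 0 ≤ c → c ≤ 1 → c • x ∈ ballBody p g := by
    intro x hx c hc hc1
    rw [mem_ballBody_iff hn hp] at hx ⊢
    rcases hc.eq_or_lt with rfl | hc
    · left; simp
    rcases hx with rfl | hx
    · left; simp
    right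
    rw [radialMoment_smul hc g x] at hx
    refine hx.trans (mul_le_of_le_one_left' ?_)
    rw [← ENNReal.ofReal_one]
    exact ENNReal.ofReal_le_ofReal (Real.rpow_le_one hc.le hc1 hp.le)
  intro x hx y hy a b ha hb hab
  rcases eq_or_ne x 0 with rfl | hx0
  · rw [smul_zero, zero_add]
    exact hstar y hy b hb (by linarith)
  rcases eq_or_ne y 0 with rfl | hy0
  · rw [smul_zero, add_zero]
    exact hstar x hx a ha (by linarith)
  rcases ha.eq_or_lt with rfl | ha
  · obtain rfl : b = 1 := by linarith
    simpa
  rcases hb.eq_or_lt with rfl | hb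
  · obtain rfl : a = 1 := by linarith
    simpa
  rw [mem_ballBody_iff hn hp] at *
  exact Or.inr (hlc.one_le_radialMoment hg heven hp (hfin x hx0) (hfin y hy0)
    (hx.resolve_left hx0) (hy.resolve_left hy0) ha hb hab)

theorem exists_radialMoment_bounds {p : ℝ} (hp : 0 < p) {g : E n → ℝ}
    (hg : IsProbabilityDensity g) (hlc : IsLogConcave g) (heven : ∀ x, g (-x) = g x) :
    ∃ m M : ℝ≥0∞, m ≠ 0 ∧ M ≠ ⊤ ∧
      ∀ v, ‖v‖ = 1 → m ≤ radialMoment p g v ∧ radialMoment p g v ≤ M := by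
  obtain ⟨ε, hε, c, hc, hball⟩ := hg.exists_ball_zero_le hlc heven
  obtain ⟨C, hC, α, hα, hdecay⟩ := hg.exists_le_exp hlc heven
  refine ⟨∫⁻ r in Ioo 0 ε, ENNReal.ofReal (r ^ (p - 1) * c),
    ∫⁻ r in Ioi (0 : ℝ), ENNReal.ofReal (C * (r ^ (p - 1) * Real.exp (-α * r ^ (1 : ℝ)))),
    ?_, ?_, fun v hv => ⟨?_, ?_⟩⟩
  · refine ((setLIntegral_pos_iff (by fun_prop)).2 ?_).ne'
    refine lt_of_lt_of_le (by simpa using hε) (measure_mono (s := Ioo 0 ε) fun r hr => ?_)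
    refine ⟨?_, hr⟩
    have := mul_pos (Real.rpow_pos_of_pos hr.1 (p - 1)) hc
    simpa [Function.mem_support] using this
  · have := ((integrableOn_rpow_mul_exp_neg_mul_rpow (s := p - 1) (by linarith) one_pos
      hα).const_mul C).lintegral_lt_top
    exact this.ne
  · refine le_trans ?_ (lintegral_mono_set (Ioo_subset_Ioi_self : Ioo 0 ε ⊆ Ioi 0))
    refine setLIntegral_mono' measurableSet_Ioo fun r hr => ENNReal.ofReal_le_ofReal ?_
    have := Real.rpow_pos_of_pos hr.1 (p - 1)
    gcongr
    apply hball
    rw [mem_ball_zero_iff, norm_smul, hv, mul_one, Real.norm_of_nonneg hr.1.le]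
    exact hr.2
  · refine setLIntegral_mono' measurableSet_Ioi fun r hr => ENNReal.ofReal_le_ofReal ?_
    have := Real.rpow_pos_of_pos hr (p - 1)
    have h1 := hdecay (r • v)
    rw [norm_smul, hv, mul_one, Real.norm_of_nonneg (le_of_lt hr)] at h1
    rw [Real.rpow_one, mul_left_comm, neg_mul]
    gcongr

theorem isSymmetricConvexBody_ballBody (hn : 1 ≤ n) {p : ℝ} (hp : 0 < p) {g : E n → ℝ}
    (hg : IsProbabilityDensity g) (hlc : IsLogConcave g) (heven : ∀ x, g (-x) = g x) :
    IsSymmetricConvexBody (ballBody p g) := by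
  obtain ⟨m, M, hm, hM, hbd⟩ := exists_radialMoment_bounds hp hg hlc heven
  have hp' : 0 < 1 / p := by positivity
  refine isSymmetricConvexBody_bodyOfRadial hn (m := m ^ (1 / p)) (M := M ^ (1 / p)) ?_ ?_
    (fun v hv => ENNReal.rpow_le_rpow (hbd v hv).1 hp'.le)
    (fun v hv => ENNReal.rpow_le_rpow (hbd v hv).2 hp'.le) (fun v => ?_) ?_
  · simp [ENNReal.rpow_eq_zero_iff, hm, hp.le]
  · exact ENNReal.rpow_ne_top_of_nonneg hp'.le hM
  · simp only [smul_neg, heven]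
  · refine convex_ballBody hn hp hlc hg.nonneg heven fun x hx => ?_
    have hx' : 0 < ‖x‖ := norm_pos_iff.2 hx
    rw [radialMoment_smul (inv_pos.2 hx')]
    refine ENNReal.mul_ne_top ENNReal.ofReal_ne_top (ne_top_of_le_ne_top hM (hbd _ ?_).2)
    rw [norm_smul, norm_inv, norm_norm, inv_mul_cancel₀ hx'.ne']

end Bodies

/-! ### Hyperplane integrals and Busemann's theorem. -/

section Busemann

open Set InnerProductSpace

variable {n : ℕ}

/-- Since `exp s ≥ s ^ (m + 1) / (m + 1)!`, the exponential is dominated by a multiple of `(1 + ‖c‖)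
^ (-(m + 1))`, integrable in dimension `m`. -/
theorem integrable_exp_neg_mul_norm (m : ℕ) {α : ℝ} (hα : 0 < α) :
    Integrable (fun c : Fin m → ℝ => Real.exp (-(α * ‖c‖))) volume := by
  have h1 : Integrable (fun c : Fin m → ℝ => (1 + ‖c‖) ^ (-((m : ℝ) + 1))) volume :=
    integrable_one_add_norm (by simp)
  refine (h1.const_mul (Real.exp α * (m + 1).factorial / α ^ (m + 1))).mono'
    (by fun_prop) (ae_of_all _ fun c => ?_)
  have hpos : 0 < 1 + ‖c‖ := by positivity
  rw [Real.norm_of_nonneg (Real.exp_pos _).le, Real.rpow_neg hpos.le]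
  have e : (1 + ‖c‖) ^ ((m : ℝ) + 1) = (1 + ‖c‖) ^ (m + 1) := by
    rw [← Real.rpow_natCast]; push_cast; rfl
  rw [e]
  have h2 := Real.pow_div_factorial_le_exp (α * (1 + ‖c‖)) (by positivity) (m + 1)
  rw [div_le_iff₀ (by positivity), mul_pow] at h2
  have h3 : Real.exp (α * (1 + ‖c‖)) * Real.exp (-(α * ‖c‖)) = Real.exp α := by
    rw [← Real.exp_add]; ring_nf
  rw [div_mul_eq_mul_div, le_div_iff₀ (by positivity), ← div_eq_mul_inv, le_div_iff₀ (by positivity),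
    ← h3]
  calc Real.exp (-(α * ‖c‖)) * α ^ (m + 1) * (1 + ‖c‖) ^ (m + 1)
      = Real.exp (-(α * ‖c‖)) * (α ^ (m + 1) * (1 + ‖c‖) ^ (m + 1)) := by ring
    _ ≤ Real.exp (-(α * ‖c‖)) * (Real.exp (α * (1 + ‖c‖)) * (m + 1).factorial) := by gcongr
    _ = _ := by ring

theorem Orthonormal.pi_norm_le {m : ℕ} {b : Fin m → E n} (hb : Orthonormal ℝ b) (c : Fin m → ℝ) :
    ‖c‖ ≤ ‖∑ i, c i • b i‖ := by
  refine (pi_norm_le_iff_of_nonneg (norm_nonneg _)).2 fun i => ?_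
  have h1 := hb.inner_right_fintype c i
  rw [← h1]
  refine (norm_inner_le_norm _ _).trans ?_
  rw [hb.1 i, one_mul]

theorem Orthonormal.norm_sum_smul_le {m : ℕ} {b : Fin m → E n} (hb : Orthonormal ℝ b)
    (c : Fin m → ℝ) : ‖∑ i, c i • b i‖ ≤ m * ‖c‖ := by
  calc ‖∑ i, c i • b i‖ ≤ ∑ i, ‖c i • b i‖ := norm_sum_le _ _
    _ ≤ ∑ _i : Fin m, ‖c‖ := Finset.sum_le_sum fun i _ => by
      rw [norm_smul, hb.1 i, mul_one]; exact norm_le_pi_norm c i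
    _ = m * ‖c‖ := by simp

theorem finrank_perp {m : ℕ} (hmn : m + 1 = n) {x : E n} (hx : x ≠ 0) :
    Module.finrank ℝ (perp x) = m := by
  have : Fact (Module.finrank ℝ (E n) = m + 1) := ⟨by simp [hmn]⟩
  exact Submodule.finrank_orthogonal_span_singleton hx

/-- Coordinates in an orthonormal basis preserve volume. The basis is left free so that it can later
be adapted to a plane containing `x`. -/
theorem lintegral_perp_eq {m : ℕ} (hmn : m + 1 = n) {x : E n} (hx : x ≠ 0) {b : Fin m → E n}
    (hb : Orthonormal ℝ b) (hbx : ∀ i, inner ℝ x (b i) = 0) (F : E n → ℝ≥0∞) :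
    ∫⁻ z : perp x, F z = ∫⁻ c : Fin m → ℝ, F (∑ i, c i • b i) := by
  set b' : Fin m → perp x := fun i =>
    ⟨b i, Submodule.mem_orthogonal_singleton_iff_inner_right.2 (hbx i)⟩ with hb'def
  have hb' : Orthonormal ℝ b' := by
    constructor
    · intro i; exact hb.1 i
    · intro i j hij; exact hb.2 hij
  have hspan := hb'.linearIndependent.span_eq_top_of_card_eq_finrank'
    (by rw [finrank_perp hmn hx, Fintype.card_fin])
  set B := OrthonormalBasis.mk hb' hspan.ge with hB
  have h1 := (B.measurePreserving_repr_symm.comp (PiLp.volume_preserving_toLp (Fin m))).lintegral_comp_emb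
    (B.measurableEquiv.symm.measurableEmbedding.comp
      (MeasurableEquiv.toLp 2 (Fin m → ℝ)).measurableEmbedding) (fun z : perp x => F z)
  rw [← h1]
  refine lintegral_congr fun c => ?_
  have : B.repr.symm (WithLp.toLp 2 c) = ∑ i, c i • b' i := by
    rw [← B.sum_repr_symm]
    simp [hB]
  rw [Function.comp_apply, this]
  simp [hb'def]

theorem exists_orthonormal_perp {m : ℕ} (hmn : m + 1 = n) {x : E n} (hx : x ≠ 0) :
    ∃ b : Fin m → E n, Orthonormal ℝ b ∧ ∀ i, inner ℝ x (b i) = 0 := by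
  let B := (stdOrthonormalBasis ℝ (perp x)).reindex (finCongr (finrank_perp hmn hx))
  refine ⟨fun i => B i, ?_, fun i => ?_⟩
  · exact B.orthonormal.comp_linearIsometry (perp x).subtypeₗᵢ
  · exact Submodule.mem_orthogonal_singleton_iff_inner_right.1 (B i).2

/-- The integral of `g` over the hyperplane through the origin perpendicular to `x`. -/
noncomputable def hyperplaneIntegral (g : E n → ℝ) (x : E n) : ℝ≥0∞ :=
  ∫⁻ z : perp x, ENNReal.ofReal (g z)

theorem hyperplaneIntegral_smul {c : ℝ} (hc : c ≠ 0) (g : E n → ℝ) (x : E n) :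
    hyperplaneIntegral g (c • x) = hyperplaneIntegral g x := by
  -- The domain of integration is a type depending on `x`, so the equality of subspaces is
  -- transported by substitution.
  have key : ∀ P Q : Submodule ℝ (E n), P = Q →
      ∫⁻ z : P, ENNReal.ofReal (g z) = ∫⁻ z : Q, ENNReal.ofReal (g z) := by
    rintro P Q rfl; rfl
  exact key _ _ (by rw [perp, Submodule.span_singleton_smul_eq (IsUnit.mk0 c hc)])

theorem exists_hyperplaneIntegral_bounds (hn : 1 ≤ n) {g : E n → ℝ}
    (hg : IsProbabilityDensity g) (hlc : IsLogConcave g) (heven : ∀ x, g (-x) = g x) :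
    ∃ m M : ℝ≥0∞, m ≠ 0 ∧ M ≠ ⊤ ∧
      ∀ x, x ≠ 0 → m ≤ hyperplaneIntegral g x ∧ hyperplaneIntegral g x ≤ M := by
  obtain ⟨ε, hε, c₀, hc₀, hball⟩ := hg.exists_ball_zero_le hlc heven
  obtain ⟨C, hC, α, hα, hdecay⟩ := hg.exists_le_exp hlc heven
  obtain ⟨k, rfl⟩ : ∃ k, n = k + 1 := ⟨n - 1, by omega⟩
  have hδ : 0 < ε / (k + 1) := by positivity
  refine ⟨ENNReal.ofReal c₀ * volume (Metric.ball (0 : Fin k → ℝ) (ε / (k + 1))),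
    ∫⁻ c : Fin k → ℝ, ENNReal.ofReal (C * Real.exp (-(α * ‖c‖))), ?_, ?_, fun x hx => ?_⟩
  · exact mul_ne_zero (by simpa using hc₀) (Metric.measure_ball_pos _ _ hδ).ne'
  · exact ((integrable_exp_neg_mul_norm k hα).const_mul C).lintegral_lt_top.ne
  obtain ⟨b, hb, hbx⟩ := exists_orthonormal_perp rfl hx
  rw [hyperplaneIntegral, lintegral_perp_eq rfl hx hb hbx (fun z => ENNReal.ofReal (g z))]
  constructor
  · rw [← setLIntegral_const]
    refine le_trans (setLIntegral_mono' measurableSet_ball fun c hc => ?_) (setLIntegral_le_lintegral _ _)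
    refine ENNReal.ofReal_le_ofReal (hball _ ?_)
    rw [mem_ball_zero_iff] at hc ⊢
    refine (hb.norm_sum_smul_le c).trans_lt ?_
    rw [lt_div_iff₀ (by positivity)] at hc
    nlinarith [norm_nonneg c]
  · refine lintegral_mono fun c => ENNReal.ofReal_le_ofReal ((hdecay _).trans ?_)
    gcongr
    exact hb.pi_norm_le c

theorem mem_intersectionBodyOfDensity_iff (hn : 1 ≤ n) {g : E n → ℝ} {x : E n} :
    x ∈ intersectionBodyOfDensity g ↔ x = 0 ∨ ENNReal.ofReal ‖x‖ ≤ hyperplaneIntegral g x := by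
  rw [intersectionBodyOfDensity, mem_bodyOfRadial_iff hn]
  refine or_congr_right' fun hx => ?_
  change _ ≤ hyperplaneIntegral g (‖x‖⁻¹ • x) ↔ _
  rw [hyperplaneIntegral_smul (inv_ne_zero (norm_ne_zero_iff.2 hx))]

/-- The integral of `g` over the affine subspace through `u` in the directions `w`. -/
noncomputable def fiberIntegral {k : ℕ} (w : Fin k → E n) (g : E n → ℝ) (u : E n) : ℝ≥0∞ :=
  ∫⁻ c : Fin k → ℝ, ENNReal.ofReal (g (u + ∑ i, c i • w i))

theorem fiberIntegral_neg {k : ℕ} (w : Fin k → E n) {g : E n → ℝ} (heven : ∀ x, g (-x) = g x)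
    (u : E n) : fiberIntegral w g (-u) = fiberIntegral w g u := by
  rw [fiberIntegral, fiberIntegral, ← lintegral_neg_eq_self]
  refine lintegral_congr fun c => ?_
  rw [← heven]
  simp [add_comm]

theorem fiberIntegral_ne_top {k : ℕ} {w : Fin k → E n} (hw : Orthonormal ℝ w) {g : E n → ℝ}
    (hg : IsProbabilityDensity g) (hlc : IsLogConcave g) (heven : ∀ x, g (-x) = g x) (u : E n) :
    fiberIntegral w g u ≠ ⊤ := by
  obtain ⟨C, hC, α, hα, hdecay⟩ := hg.exists_le_exp hlc heven
  refine ne_top_of_le_ne_top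
    ((integrable_exp_neg_mul_norm k hα).const_mul (C * Real.exp (α * ‖u‖))).lintegral_lt_top.ne
    (lintegral_mono fun c => ENNReal.ofReal_le_ofReal ((hdecay _).trans ?_))
  rw [mul_assoc, ← Real.exp_add]
  gcongr
  have h1 := hw.pi_norm_le c
  have h2 := norm_sub_le (u + ∑ i, c i • w i) u
  rw [add_sub_cancel_left] at h2
  nlinarith

theorem rpow_fiberIntegral_mul_le {k : ℕ} (w : Fin k → E n) {g : E n → ℝ}
    (hg : IsProbabilityDensity g) (hlc : IsLogConcave g) {a b : ℝ} (ha : 0 < a) (hb : 0 < b)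
    (hab : a + b = 1) (x y : E n) :
    fiberIntegral w g x ^ a * fiberIntegral w g y ^ b ≤ fiberIntegral w g (a • x + b • y) := by
  have hm := hg.measurable
  refine prekopaLeindler_pi k a b ha hb hab _ _ _ (by fun_prop) (by fun_prop) (by fun_prop)
    fun c d => ?_
  rw [ENNReal.ofReal_rpow_of_nonneg (hg.nonneg _) ha.le,
    ENNReal.ofReal_rpow_of_nonneg (hg.nonneg _) hb.le,
    ← ENNReal.ofReal_mul (Real.rpow_nonneg (hg.nonneg _) _)]
  refine ENNReal.ofReal_le_ofReal ((hlc _ _ a b ha.le hb.le hab).trans (le_of_eq ?_))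
  congr 1
  simp only [Pi.add_apply, Pi.smul_apply, smul_eq_mul, add_smul, Finset.sum_add_distrib, smul_add,
    Finset.smul_sum, smul_smul]
  abel

/-- Marginals of log-concave functions are log-concave. The factor `2` lets a half-line moment of
this even function account for the whole line. -/
theorem isLogConcave_fiberIntegral {k : ℕ} {w : Fin k → E n} (hw : Orthonormal ℝ w) {g : E n → ℝ}
    (hg : IsProbabilityDensity g) (hlc : IsLogConcave g) (heven : ∀ x, g (-x) = g x) :
    IsLogConcave fun u => (2 * fiberIntegral w g u).toReal := by
  intro x y a b ha hb hab
  rcases ha.eq_or_lt with rfl | ha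
  · obtain rfl : b = 1 := by linarith
    simp
  rcases hb.eq_or_lt with rfl | hb
  · obtain rfl : a = 1 := by linarith
    simp
  simp only
  rw [ENNReal.toReal_rpow, ENNReal.toReal_rpow, ← ENNReal.toReal_mul]
  refine ENNReal.toReal_mono
    (ENNReal.mul_ne_top ENNReal.ofNat_ne_top (fiberIntegral_ne_top hw hg hlc heven _)) ?_
  rw [ENNReal.mul_rpow_of_nonneg _ _ ha.le, ENNReal.mul_rpow_of_nonneg _ _ hb.le,
    mul_mul_mul_comm, ← ENNReal.rpow_add _ _ two_ne_zero ENNReal.ofNat_ne_top, hab,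
    ENNReal.rpow_one]
  gcongr
  exact rpow_fiberIntegral_mul_le w hg hlc ha hb hab x y

theorem lintegral_eq_two_mul_lintegral_Ioi {H : ℝ → ℝ≥0∞} (hH : ∀ r, H (-r) = H r) :
    ∫⁻ r, H r = 2 * ∫⁻ r in Ioi (0 : ℝ), H r := by
  rw [← lintegral_add_compl H (measurableSet_Ioi (a := (0 : ℝ))), two_mul]
  congr 1
  have h := (Measure.measurePreserving_neg (volume : Measure ℝ)).setLIntegral_comp_preimage_emb
    (MeasurableEquiv.neg ℝ).measurableEmbedding H (Ioi 0)
  rw [← h, compl_Ioi, setLIntegral_congr Iio_ae_eq_Iic.symm]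
  simp [hH]

theorem norm_smul_add_smul_sq {e₀ e₁ : E n} (h₀ : ‖e₀‖ = 1) (h₁ : ‖e₁‖ = 1)
    (h₀₁ : inner ℝ e₀ e₁ = 0) (s t : ℝ) : ‖s • e₀ + t • e₁‖ ^ 2 = s ^ 2 + t ^ 2 := by
  rw [norm_add_sq_real, norm_smul, norm_smul, h₀, h₁, real_inner_smul_left, real_inner_smul_right,
    h₀₁]
  simp

/-- For `u` in the plane of `e₀`, `e₁`, the hyperplane `u^⊥` is spanned by the quarter turn of `u`
and the `w i`. Integrating over the `w i` leaves an even function on a line; using the quarter turn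
unnormalised produces the factor `‖u‖`, which cancels against the norm in the membership condition.
-/
theorem hyperplaneIntegral_eq {k : ℕ} {e₀ e₁ : E (k + 2)} {w : Fin k → E (k + 2)}
    (h₀ : ‖e₀‖ = 1) (h₁ : ‖e₁‖ = 1) (h₀₁ : inner ℝ e₀ e₁ = 0) (hw : Orthonormal ℝ w)
    (hw₀ : ∀ i, inner ℝ e₀ (w i) = 0) (hw₁ : ∀ i, inner ℝ e₁ (w i) = 0) {g : E (k + 2) → ℝ}
    (hg : IsProbabilityDensity g) (heven : ∀ x, g (-x) = g x) {s t : ℝ}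
    (hu : s • e₀ + t • e₁ ≠ 0) :
    hyperplaneIntegral g (s • e₀ + t • e₁) = ENNReal.ofReal ‖s • e₀ + t • e₁‖ *
      (2 * ∫⁻ r in Ioi (0 : ℝ), fiberIntegral w g (r • ((-t) • e₀ + s • e₁))) := by
  set u := s • e₀ + t • e₁ with hudef
  set u' := (-t) • e₀ + s • e₁ with hu'def
  have hupos : 0 < ‖u‖ := norm_pos_iff.2 hu
  have hnorm : ‖u'‖ = ‖u‖ := by
    rw [← sq_eq_sq₀ (norm_nonneg _) (norm_nonneg _), hu'def, hudef,
      norm_smul_add_smul_sq h₀ h₁ h₀₁, norm_smul_add_smul_sq h₀ h₁ h₀₁]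
    ring
  have h₁₀ : inner ℝ e₁ e₀ = 0 := by rw [real_inner_comm]; exact h₀₁
  have hortho : inner ℝ u u' = 0 := by
    simp only [hudef, hu'def, inner_add_left, inner_add_right, real_inner_smul_left,
      real_inner_smul_right, h₀₁, h₁₀, real_inner_self_eq_norm_sq, h₀, h₁]
    ring
  have huw : ∀ i, inner ℝ u (w i) = 0 := by
    intro i
    rw [hudef, inner_add_left, real_inner_smul_left, real_inner_smul_left, hw₀, hw₁]
    simp
  have hu'w : ∀ i, inner ℝ u' (w i) = 0 := by
    intro i
    rw [hu'def, inner_add_left, real_inner_smul_left, real_inner_smul_left, hw₀, hw₁]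
    simp
  set b : Fin (k + 1) → E (k + 2) := Fin.cons (‖u‖⁻¹ • u') w with hbdef
  have hb : Orthonormal ℝ b := by
    constructor
    · intro i
      refine Fin.cases ?_ (fun j => ?_) i
      · rw [hbdef, Fin.cons_zero, norm_smul, hnorm, norm_inv, norm_norm, inv_mul_cancel₀ hupos.ne']
      · rw [hbdef, Fin.cons_succ]; exact hw.1 j
    · intro i j
      refine Fin.cases ?_ (fun i => ?_) i <;> refine Fin.cases ?_ (fun j => ?_) j
      · intro h; exact absurd rfl h
      · intro _
        simp [hbdef, real_inner_smul_left, hu'w]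
      · intro _
        rw [hbdef, Fin.cons_zero, Fin.cons_succ, real_inner_smul_right, real_inner_comm, hu'w,
          mul_zero]
      · intro h
        simp only [hbdef, Fin.cons_succ]
        exact hw.2 fun h' => h (by rw [h'])
  have hbu : ∀ i, inner ℝ u (b i) = 0 := by
    intro i
    refine Fin.cases ?_ (fun j => ?_) i
    · rw [hbdef, Fin.cons_zero, real_inner_smul_right, hortho, mul_zero]
    · rw [hbdef, Fin.cons_succ]; exact huw j
  have hm := hg.measurable
  rw [hyperplaneIntegral, lintegral_perp_eq rfl hu hb hbu (fun z => ENNReal.ofReal (g z)),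
    ← (volume_preserving_piFinSuccAbove (fun _ => ℝ) (0 : Fin (k + 1))).symm.lintegral_comp_emb
      (MeasurableEquiv.measurableEmbedding _), Measure.volume_eq_prod, lintegral_prod]
  · have e : ∀ r : ℝ, ∫⁻ c : Fin k → ℝ, ENNReal.ofReal
        (g (∑ i, ((MeasurableEquiv.piFinSuccAbove (fun _ => ℝ) (0 : Fin (k + 1))).symm (r, c)) i • b i))
        = fiberIntegral w g ((r * ‖u‖⁻¹) • u') := by
      intro r
      refine lintegral_congr fun c => ?_
      rw [Fin.sum_univ_succ]
      simp [MeasurableEquiv.piFinSuccAbove, Fin.insertNthEquiv, hbdef, smul_smul]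
    simp_rw [e]
    rw [lintegral_eq_two_mul_lintegral_Ioi (H := fun r => fiberIntegral w g ((r * ‖u‖⁻¹) • u')),
      lintegral_Ioi_comp_mul_left hupos, mul_left_comm]
    · congr 3
      ext r
      congr 2
      field_simp
    · intro r
      rw [neg_mul, neg_smul, fiberIntegral_neg w heven]
  · apply Measurable.aemeasurable
    have h2 := (MeasurableEquiv.piFinSuccAbove (fun _ => ℝ) (0 : Fin (k + 1))).symm.measurable
    refine ENNReal.measurable_ofReal.comp (hm.comp ?_)
    refine Finset.measurable_sum _ fun i _ => ?_
    exact ((measurable_pi_apply i).comp h2).smul_const _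

theorem exists_orthonormal_frame {k : ℕ} {x y : E (k + 2)} (h : LinearIndependent ℝ ![x, y]) :
    ∃ (e₀ e₁ : E (k + 2)) (w : Fin k → E (k + 2)), ‖e₀‖ = 1 ∧ ‖e₁‖ = 1 ∧ inner ℝ e₀ e₁ = 0 ∧
      Orthonormal ℝ w ∧ (∀ i, inner ℝ e₀ (w i) = 0) ∧ (∀ i, inner ℝ e₁ (w i) = 0) ∧
      (∃ s t : ℝ, x = s • e₀ + t • e₁) ∧ ∃ s t : ℝ, y = s • e₀ + t • e₁ := by
  set P := Submodule.span ℝ (range ![x, y]) with hP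
  have hP2 : Module.finrank ℝ P = 2 := by rw [hP, finrank_span_eq_card h, Fintype.card_fin]
  have hPk : Module.finrank ℝ Pᗮ = k :=
    Submodule.finrank_add_finrank_orthogonal' (by rw [hP2]; simp [add_comm])
  let e := (stdOrthonormalBasis ℝ P).reindex (finCongr hP2)
  let w := (stdOrthonormalBasis ℝ Pᗮ).reindex (finCongr hPk)
  have hcoord : ∀ z ∈ P, ∃ s t : ℝ, z = s • (e 0 : E (k + 2)) + t • (e 1 : E (k + 2)) := by
    intro z hz
    refine ⟨e.repr ⟨z, hz⟩ 0, e.repr ⟨z, hz⟩ 1, ?_⟩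
    have := congrArg (Subtype.val) (e.sum_repr ⟨z, hz⟩)
    rw [Fin.sum_univ_two] at this
    exact this.symm
  refine ⟨e 0, e 1, fun i => w i, e.orthonormal.1 0, e.orthonormal.1 1,
    e.orthonormal.2 (by decide), w.orthonormal.comp_linearIsometry Pᗮ.subtypeₗᵢ,
    fun i => (w i).2 _ (e 0).2, fun i => (w i).2 _ (e 1).2, hcoord x ?_, hcoord y ?_⟩
  · exact Submodule.subset_span ⟨0, rfl⟩
  · exact Submodule.subset_span ⟨1, rfl⟩

/-- Busemann's theorem for even log-concave densities. -/
theorem convex_intersectionBodyOfDensity (hn : 1 ≤ n) {g : E n → ℝ}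
    (hg : IsProbabilityDensity g) (hlc : IsLogConcave g) (heven : ∀ x, g (-x) = g x) :
    Convex ℝ (intersectionBodyOfDensity g) := by
  obtain ⟨_, M, _, hM, hbd⟩ := exists_hyperplaneIntegral_bounds hn hg hlc heven
  -- Negative `c` is allowed so that collinear points on opposite sides of `0` are covered.
  have hstar : ∀ x ∈ intersectionBodyOfDensity g, ∀ c : ℝ, |c| ≤ 1 →
      c • x ∈ intersectionBodyOfDensity g := by
    intro x hx c hc1
    rw [mem_intersectionBodyOfDensity_iff hn] at hx ⊢
    rcases eq_or_ne c 0 with rfl | hc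
    · left; simp
    rcases hx with rfl | hx
    · left; simp
    right
    rw [hyperplaneIntegral_smul hc, norm_smul]
    refine le_trans (ENNReal.ofReal_le_ofReal ?_) hx
    exact mul_le_of_le_one_left (norm_nonneg _) hc1
  intro x hx y hy a b ha hb hab
  rcases eq_or_ne x 0 with rfl | hx0
  · rw [smul_zero, zero_add]
    exact hstar y hy b (by rw [abs_of_nonneg hb]; linarith)
  rcases eq_or_ne y 0 with rfl | hy0
  · rw [smul_zero, add_zero]
    exact hstar x hx a (by rw [abs_of_nonneg ha]; linarith)
  by_cases hli : LinearIndependent ℝ ![x, y]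
  · rcases ha.eq_or_lt with rfl | ha
    · obtain rfl : b = 1 := by linarith
      simpa
    rcases hb.eq_or_lt with rfl | hb
    · obtain rfl : a = 1 := by linarith
      simpa
    obtain ⟨k, rfl⟩ : ∃ k, n = k + 2 := by
      have := hli.fintype_card_le_finrank
      simp only [Fintype.card_fin, finrank_euclideanSpace] at this
      exact ⟨n - 2, by omega⟩
    obtain ⟨e₀, e₁, w, h₀, h₁, h₀₁, hw, hw₀, hw₁, ⟨s, t, rfl⟩, ⟨s', t', rfl⟩⟩ :=
      exists_orthonormal_frame hli
    set G : E (k + 2) → ℝ := fun u => (2 * fiberIntegral w g u).toReal with hG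
    have hGlc : IsLogConcave G := isLogConcave_fiberIntegral hw hg hlc heven
    have hG0 : ∀ u, 0 ≤ G u := fun u => ENNReal.toReal_nonneg
    have hGeven : ∀ u, G (-u) = G u := fun u => by simp only [hG, fiberIntegral_neg w heven]
    have hmom : ∀ s t : ℝ, s • e₀ + t • e₁ ≠ 0 → hyperplaneIntegral g (s • e₀ + t • e₁) =
        ENNReal.ofReal ‖s • e₀ + t • e₁‖ * radialMoment 1 G ((-t) • e₀ + s • e₁) := by
      intro s t hst
      rw [hyperplaneIntegral_eq h₀ h₁ h₀₁ hw hw₀ hw₁ hg heven hst, radialMoment,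
        ← lintegral_const_mul' _ _ ENNReal.ofNat_ne_top]
      congr 1
      refine setLIntegral_congr_fun measurableSet_Ioi fun r hr => ?_
      simp only [sub_self, Real.rpow_zero, one_mul, hG]
      rw [ENNReal.ofReal_toReal]
      exact ENNReal.mul_ne_top ENNReal.ofNat_ne_top (fiberIntegral_ne_top hw hg hlc heven _)
    have hmem : ∀ s t : ℝ, s • e₀ + t • e₁ ≠ 0 →
        (s • e₀ + t • e₁ ∈ intersectionBodyOfDensity g ↔
          1 ≤ radialMoment 1 G ((-t) • e₀ + s • e₁)) := by
      intro s t hst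
      have hpos : ENNReal.ofReal ‖s • e₀ + t • e₁‖ ≠ 0 := by simpa using hst
      rw [mem_intersectionBodyOfDensity_iff hn, or_iff_right hst, hmom s t hst]
      conv_lhs => lhs; rw [← mul_one (ENNReal.ofReal ‖s • e₀ + t • e₁‖)]
      rw [ENNReal.mul_le_mul_iff_right hpos ENNReal.ofReal_ne_top]
    have hfin : ∀ s t : ℝ, s • e₀ + t • e₁ ≠ 0 →
        radialMoment 1 G ((-t) • e₀ + s • e₁) ≠ ⊤ := by
      intro s t hst htop
      have h := (hbd _ hst).2
      rw [hmom s t hst, htop, ENNReal.mul_top (by simpa using hst)] at h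
      exact hM (top_le_iff.1 h)
    have hz : a • (s • e₀ + t • e₁) + b • (s' • e₀ + t' • e₁) =
        (a * s + b * s') • e₀ + (a * t + b * t') • e₁ := by module
    have hz0 : a • (s • e₀ + t • e₁) + b • (s' • e₀ + t' • e₁) ≠ 0 := fun h =>
      ha.ne' (LinearIndependent.pair_iff.1 hli a b h).1
    rw [hz] at hz0 ⊢
    rw [hmem _ _ hx0] at hx
    rw [hmem _ _ hy0] at hy
    rw [hmem _ _ hz0]
    -- The quarter turn `(s, t) ↦ (-t, s)` is linear, so it commutes with the convex combination.
    have := hGlc.one_le_radialMoment hG0 hGeven one_pos (hfin _ _ hx0) (hfin _ _ hy0) hx hy ha hb hab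
    convert this using 2
    module
  -- Collinear points: the combination is a multiple, with factor at most `1` in absolute value, of
  -- the longer of the two.
  · rw [LinearIndependent.pair_iff' hx0] at hli
    push Not at hli
    obtain ⟨c, rfl⟩ := hli
    have hz : a • x + b • c • x = (a + b * c) • x := by module
    rw [hz]
    rcases le_or_gt |c| 1 with hc | hc
    · refine hstar x hx _ ?_
      calc |a + b * c| ≤ |a| + |b * c| := abs_add_le _ _
        _ = a + b * |c| := by rw [abs_mul, abs_of_nonneg ha, abs_of_nonneg hb]
        _ ≤ 1 := by nlinarith
    · have hc0 : c ≠ 0 := by rintro rfl; simp at hc; linarith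
      have e : (a + b * c) • x = ((a + b * c) * c⁻¹) • c • x := by
        rw [smul_smul, inv_mul_cancel_right₀ hc0]
      rw [e]
      refine hstar _ hy _ ?_
      rw [abs_mul, abs_inv, ← div_eq_mul_inv, div_le_one (by positivity)]
      calc |a + b * c| ≤ |a| + |b * c| := abs_add_le _ _
        _ = a + b * |c| := by rw [abs_mul, abs_of_nonneg ha, abs_of_nonneg hb]
        _ ≤ |c| := by nlinarith

theorem isSymmetricConvexBody_intersectionBodyOfDensity (hn : 1 ≤ n) {g : E n → ℝ}
    (hg : IsProbabilityDensity g) (hlc : IsLogConcave g) (heven : ∀ x, g (-x) = g x) :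
    IsSymmetricConvexBody (intersectionBodyOfDensity g) := by
  obtain ⟨m, M, hm, hM, hbd⟩ := exists_hyperplaneIntegral_bounds hn hg hlc heven
  have hne : ∀ v : E n, ‖v‖ = 1 → v ≠ 0 := by
    rintro v hv rfl
    simp at hv
  refine isSymmetricConvexBody_bodyOfRadial hn hm hM (fun v hv => (hbd v (hne v hv)).1)
    (fun v hv => (hbd v (hne v hv)).2) (fun v => ?_)
    (convex_intersectionBodyOfDensity hn hg hlc heven)
  have := hyperplaneIntegral_smul (neg_ne_zero.2 one_ne_zero) g v
  rwa [neg_smul, one_smul] at this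

end Busemann

/-! ### Polar coordinates and the volume of sections of Ball bodies. -/

section Polar

open Set

theorem lintegral_eq_lintegral_toSphere {V : Type*} [NormedAddCommGroup V] [InnerProductSpace ℝ V]
    [FiniteDimensional ℝ V] [MeasurableSpace V] [BorelSpace V] [Nontrivial V] {F : V → ℝ≥0∞}
    (hF : Measurable F) :
    ∫⁻ z, F z = ∫⁻ θ : Metric.sphere (0 : V) 1, (∫⁻ r in Ioi (0 : ℝ),
      ENNReal.ofReal (r ^ (Module.finrank ℝ V - 1)) * F (r • (θ : V)))
      ∂(volume : Measure V).toSphere := by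
  have h1 := (volume : Measure V).measurePreserving_homeomorphUnitSphereProd
  have h2 : ∀ z : ({0}ᶜ : Set V), F z =
      (fun q : Metric.sphere (0 : V) 1 × Ioi (0 : ℝ) => F ((q.2 : ℝ) • (q.1 : V)))
        (homeomorphUnitSphereProd V z) := by
    intro z
    have hz : ‖(z : V)‖ ≠ 0 := norm_ne_zero_iff.2 z.2
    simp [smul_inv_smul₀ hz]
  rw [← setLIntegral_univ, ← setLIntegral_congr (ae_eq_univ.2 (by simp) : ({0}ᶜ : Set V) =ᵐ[volume] univ),
    ← lintegral_subtype_comap (measurableSet_singleton (0 : V)).compl, lintegral_congr h2]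
  refine (h1.lintegral_comp_emb (Homeomorph.measurableEmbedding _)
    (fun q : Metric.sphere (0 : V) 1 × Ioi (0 : ℝ) => F ((q.2 : ℝ) • (q.1 : V)))).trans ?_
  rw [lintegral_prod]
  · refine lintegral_congr fun θ => ?_
    rw [Measure.volumeIoiPow, lintegral_withDensity_eq_lintegral_mul,
      ← lintegral_subtype_comap measurableSet_Ioi]
    · rfl
    · fun_prop
    · fun_prop
  · fun_prop

theorem lintegral_Ioi_pow_mul_indicator (k : ℕ) {R : ℝ} (hR : 0 ≤ R) {F : ℝ → ℝ≥0∞}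
    (hF : ∀ r, 0 < r → F r = if r ≤ R then 1 else 0) :
    ENNReal.ofReal (k + 1) * ∫⁻ r in Ioi (0 : ℝ), ENNReal.ofReal (r ^ k) * F r =
      ENNReal.ofReal (R ^ (k + 1)) := by
  have h1 : ∫⁻ r in Ioi (0 : ℝ), ENNReal.ofReal (r ^ k) * F r =
      ∫⁻ r in Ioc 0 R, ENNReal.ofReal (r ^ k) := by
    rw [← Ioi_inter_Iic, inter_comm, ← Measure.restrict_restrict measurableSet_Iic,
      ← lintegral_indicator measurableSet_Iic]
    refine setLIntegral_congr_fun measurableSet_Ioi fun r hr => ?_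
    simp only [hF r hr, indicator, mem_Iic]
    split_ifs <;> simp
  rw [h1, ← ofReal_integral_eq_lintegral_ofReal, ← intervalIntegral.integral_of_le hR, integral_pow,
    ← ENNReal.ofReal_mul (by positivity)]
  · congr 1
    field_simp
    simp
  · exact (intervalIntegral.intervalIntegrable_pow k).1
  · filter_upwards [ae_restrict_mem measurableSet_Ioc] with r hr
    exact pow_nonneg hr.1.le _

/-- In polar coordinates on `v^⊥`, of dimension `k + 1`, a direction contributes its moment `J = ∫
r^k g` on the left. The section has radius `J ^ (1 / (k + 1))` there and contributes `J / (k + 1)`: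
the exponent `p = k + 1` is the one for which the powers cancel. -/
theorem hyperplaneIntegral_eq_volume {k : ℕ} {g : E (k + 2) → ℝ} (hg : IsProbabilityDensity g)
    (hlc : IsLogConcave g) (heven : ∀ x, g (-x) = g x) {v : E (k + 2)} (hv : v ≠ 0) :
    hyperplaneIntegral g v = ENNReal.ofReal (k + 1) *
      volume {z : perp v | (z : E (k + 2)) ∈ ballBody (k + 1) g} := by
  have hp : (0 : ℝ) < k + 1 := by positivity
  have hn : 1 ≤ k + 2 := by omega
  have hfr : Module.finrank ℝ (perp v) = k + 1 := finrank_perp rfl hv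
  have : Nontrivial (perp v) := Module.nontrivial_of_finrank_pos (R := ℝ) (by omega)
  obtain ⟨_, M, _, hM, hbd⟩ := exists_radialMoment_bounds hp hg hlc heven
  have hK : MeasurableSet {z : perp v | (z : E (k + 2)) ∈ ballBody (k + 1) g} :=
    measurable_subtype_coe
      (isSymmetricConvexBody_ballBody hn hp hg hlc heven).isCompact.isClosed.measurableSet
  have hm := hg.measurable
  rw [hyperplaneIntegral, lintegral_eq_lintegral_toSphere (by fun_prop), ← lintegral_indicator_one hK,
    lintegral_eq_lintegral_toSphere (measurable_one.indicator hK),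
    ← lintegral_const_mul' _ _ ENNReal.ofReal_ne_top, hfr, Nat.add_sub_cancel]
  refine lintegral_congr fun θ => ?_
  have hθ : ‖((θ : perp v) : E (k + 2))‖ = 1 := norm_eq_of_mem_sphere θ
  have hJ : radialMoment (k + 1) g ((θ : perp v) : E (k + 2)) ≠ ⊤ :=
    ne_top_of_le_ne_top hM (hbd _ hθ).2
  set J := radialMoment (k + 1) g ((θ : perp v) : E (k + 2)) with hJdef
  have hR : (J ^ (1 / ((k : ℝ) + 1))) ≠ ⊤ := ENNReal.rpow_ne_top_of_nonneg (by positivity) hJ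
  rw [lintegral_Ioi_pow_mul_indicator k (R := (J ^ (1 / ((k : ℝ) + 1))).toReal) ENNReal.toReal_nonneg]
  · rw [← ENNReal.toReal_pow, ENNReal.ofReal_toReal (ENNReal.pow_ne_top hR), ← ENNReal.rpow_natCast,
      ← ENNReal.rpow_mul]
    have e : 1 / ((k : ℝ) + 1) * ((k + 1 : ℕ) : ℝ) = 1 := by push_cast; field_simp
    rw [e, ENNReal.rpow_one, hJdef, radialMoment]
    refine setLIntegral_congr_fun measurableSet_Ioi fun r hr => ?_
    rw [← ENNReal.ofReal_mul (pow_nonneg (le_of_lt hr) _), add_sub_cancel_right, Real.rpow_natCast]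
    rfl
  · intro r hr
    have hr0 : r • ((θ : perp v) : E (k + 2)) ≠ 0 :=
      smul_ne_zero hr.ne' (fun h => by rw [h, norm_zero] at hθ; exact zero_ne_one hθ)
    have hiff : r • (θ : perp v) ∈ {z : perp v | (z : E (k + 2)) ∈ ballBody (k + 1) g} ↔
        r ≤ (J ^ (1 / ((k : ℝ) + 1))).toReal := by
      rw [← ENNReal.ofReal_le_iff_le_toReal hR]
      change r • ((θ : perp v) : E (k + 2)) ∈ ballBody (k + 1) g ↔ _
      rw [ballBody, mem_bodyOfRadial_iff hn, or_iff_right hr0, norm_smul, hθ, mul_one,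
        Real.norm_of_nonneg hr.le, inv_smul_smul₀ hr.ne']
      rfl
    simp only [indicator, hiff, Pi.one_apply]

end Polar

/-! ### The Tonelli identities and the conclusion. -/

section Main

variable {n : ℕ}

/-- For exponent `1` the radial function is a plain double integral, and exchanging `x` with `z ∈
v^⊥` produces the autocorrelation at `z`. -/
theorem crossSectionBody_one_eq {f : E n → ℝ} (hf : IsProbabilityDensity f)
    (hlc : IsLogConcave f) :
    crossSectionBody 1 f = intersectionBodyOfDensity (autocorrelation f) := by
  refine bodyOfRadial_congr fun v _ => ?_
  have hm := hf.measurable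
  simp only [ENNReal.rpow_one, div_one]
  simp_rw [hf.ofReal_autocorrelation hlc]
  rw [lintegral_lintegral_swap]
  · refine lintegral_congr fun x => ?_
    rw [mul_comm, ← lintegral_const_mul' _ _ ENNReal.ofReal_ne_top]
    simp_rw [add_comm x]
  · apply Measurable.aemeasurable
    simp only [Function.uncurry_def]
    fun_prop

theorem radialMeanBody_eq_ballBody {f : E n → ℝ} (hf : IsProbabilityDensity f)
    (hlc : IsLogConcave f) (p : ℝ) :
    radialMeanBody p f = ballBody p (autocorrelation f) := by
  refine bodyOfRadial_congr fun v _ => ?_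
  have hm := hf.measurable
  congr 1
  have h1 : ∫⁻ r in Set.Ioi (0 : ℝ), ENNReal.ofReal (r ^ (p - 1) * autocorrelation f (r • v)) =
      ∫⁻ r in Set.Ioi (0 : ℝ), ∫⁻ x, ENNReal.ofReal (f x) *
        ENNReal.ofReal (r ^ (p - 1) * f (x + r • v)) := by
    refine setLIntegral_congr_fun measurableSet_Ioi fun r hr => ?_
    have hr' : 0 ≤ r ^ (p - 1) := Real.rpow_nonneg (le_of_lt hr) _
    rw [ENNReal.ofReal_mul hr', hf.ofReal_autocorrelation hlc,
      ← lintegral_const_mul' _ _ ENNReal.ofReal_ne_top]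
    refine lintegral_congr fun x => ?_
    rw [ENNReal.ofReal_mul hr', mul_left_comm, add_comm]
  rw [h1, lintegral_lintegral_swap]
  · exact lintegral_congr fun x => (lintegral_const_mul' _ _ ENNReal.ofReal_ne_top).symm
  · apply Measurable.aemeasurable
    simp only [Function.uncurry_def]
    fun_prop

theorem intersectionBodyOfDensity_eq_smul {g : E n → ℝ} (hn : 2 ≤ n) (hg : IsProbabilityDensity g)
    (hlc : IsLogConcave g) (heven : ∀ x, g (-x) = g x) :
    intersectionBodyOfDensity g = ((n : ℝ) - 1) • intersectionBody (ballBody ((n : ℝ) - 1) g) := by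
  obtain ⟨k, rfl⟩ : ∃ k, n = k + 2 := ⟨n - 2, by omega⟩
  have e : ((k + 2 : ℕ) : ℝ) - 1 = k + 1 := by push_cast; ring
  rw [e, intersectionBody, smul_bodyOfRadial (by positivity)]
  refine bodyOfRadial_congr fun v hv => ?_
  refine hyperplaneIntegral_eq_volume hg hlc heven ?_
  rintro rfl
  simp at hv

theorem mainTheorem2 (n : ℕ) (hn : 1 ≤ n) (p : ℝ) (hp : 0 < p) (f : E n → ℝ)
    (hf : IsProbabilityDensity f) (hlc : IsLogConcave f) :
    -- the integrals defining the autocorrelation converge, and it is again a log-concave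
    -- probability density, now symmetric
    ((∀ x, Integrable (fun y => f y * f (x + y)) volume) ∧
      IsProbabilityDensity (autocorrelation f) ∧ IsLogConcave (autocorrelation f) ∧
      ∀ x, autocorrelation f (-x) = autocorrelation f x) ∧
    IsSymmetricConvexBody (crossSectionBody 1 f) ∧
    IsSymmetricConvexBody (radialMeanBody p f) ∧
    crossSectionBody 1 f = intersectionBodyOfDensity (autocorrelation f) ∧
    (2 ≤ n → crossSectionBody 1 f =
      ((n : ℝ) - 1) • intersectionBody (radialMeanBody ((n : ℝ) - 1) f)) ∧
    radialMeanBody p f = ballBody p (autocorrelation f) := by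
  have hg := hf.autocorrelation hlc
  have hglc := hf.isLogConcave_autocorrelation hlc
  have heven := autocorrelation_neg f
  have hC := crossSectionBody_one_eq hf hlc
  have hR := radialMeanBody_eq_ballBody hf hlc
  refine ⟨⟨hf.integrable_mul_translate hlc, hg, hglc, heven⟩, ?_, ?_, hC, fun h2 => ?_, hR p⟩
  · rw [hC]
    exact isSymmetricConvexBody_intersectionBodyOfDensity hn hg hglc heven
  · rw [hR]
    exact isSymmetricConvexBody_ballBody hn hp hg hglc heven
  · rw [hC, hR]
    exact intersectionBodyOfDensity_eq_smul h2 hg hglc heven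

end Main
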